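/- Let $n\ge 1$ and let $p(x,y)=\sum_{i+j\le n}p_{ij}x^iy^j\in\mathbb C[x,y]$ have total degree exactly $n$. A determinantal representation of $p$ of order $m$ is a triple $A,B,C\in\mathbb C^{m\times m}$ (not necessarily symmetric) with $\det(A+xB+yC)=p(x,y)$. A polynomial is square-free if it is not a multiple of the square of a non-constant polynomial. Let $p_h(x,y,z)=\sum_{i+j\le n} p_{ij}x^iy^jz^{n-i-j}$. For a $3\times3$ matrix $T$ let $p^T$ be the polynomial obtained by setting $\tilde z=1$ in $p_h\bigl(T(\tilde x,\tilde y,\tilde z)^{\mathsf T}\bigr)$. Write $$h_p(\xi)=p_h(\xi,1,0)=\sum_{i=0}^n p_{i,n-i}\xi^i,\qquad v_p(\xi)=\sum_{i=0}^{n-1}p_{i+1,n-1-i}\,\xi^i .$$ Call $p$ *good* if it has degree $n$, $p_{n0}\neq0$ and all zeros of $h_p$ are simple. Call $p$ an *admissible input* if it has degree $n$, $p_{n0}\ne0$, $p_{0n}=p_{0,n-1}=0$ and all zeros of $v_p$ are simple and nonzero. **Algorithm.** Let $p$ be an admissible input and $\xi_1,\dots,\xi_{n-1}$ the zeros of $v_p$,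 in any order. Put $f_{j\ell}=\alpha_{j\ell}x+\beta_{j\ell}y$ for $1\le \ell\le j\le n-1$, with $\alpha_{j1}=1$, $\beta_{j1}=-\xi_j$, and $\alpha_{j\ell}=1$ for $j<n-1$. For $k\ge1$ let $q^{(k)}_0=1$ and $q^{(k)}_j=\sum_{\ell=1}^{\min(j,k)}f_{j\ell}\,q^{(k)}_{j-\ell}$. Start with $r=p-p_{n0}x\,q^{(1)}_{n-1}$. For $k=2,\dots,n-1$ do the following: 1. Put $h(t)=p_{n0}^{-1}\sum_{i=0}^{n-k}r_{i+1,n-k-i}t^i$ and $\alpha_{n-1,k}=r_{n-k+1,0}/p_{n0}-n+k+1$. 2. Put $$g(t)=h(t)-t\sum_{\ell=k}^{n-2}\prod_{i=1}^{\ell-k}(t-\xi_i)\prod_{j=\ell+1}^{n-1}(t-\xi_j)-\alpha_{n-1,k}\,t\prod_{i=1}^{n-k-1}(t-\xi_i).$$ 3. Solve the lower triangular system $\sum_{\ell=1}^{m}w_{m\ell}\,\beta_{k+\ell-1,k}=g(\xi_m)$, $m=1,\dots,n-k$, where $w_{m\ell}=\prod_{i=1}^{\ell-1}(\xi_m-\xi_i)\prod_{j=\ell+k}^{n-1}(\xi_m-\xi_j)$.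 4. Put $s=p-p_{n0}x\,q^{(k)}_{n-1}-\sum_{\ell=2}^{k-1}\gamma_{n-\ell}\,q^{(k)}_{n-\ell}$ and $\gamma_{n-k}=(-1)^{n-k}s_{0,n-k}/(\xi_1\cdots\xi_{n-k})$, and replace $r$ by $s-\gamma_{n-k}\,q^{(k)}_{n-k}$. The output is the triple $A,B,C$ for which $A+xB+yC$ has first row $(r_{00}+r_{10}x,\ \gamma_1,\dots,\gamma_{n-2},\ p_{n0}x)$, entries $1$ at the positions $(i,i)$ with $i\ge2$, entries $-f_{i-1,i-j}$ at the positions $(i,j)$ with $i>j$, and zeros elsewhere. (For $n=1$ the two entries that fall on position $(1,1)$ are added.) The following hold. 1. If $p$ is an admissible input, then for every ordering of the zeros of $v_p$ the output of the algorithm is a determinantal representation of $p$ of order $n$. 2. If $p$ is square-free, then for generic $T\in\mathbb C^{3\times3}$ (that is, for all $T$ outside the zero set of some nonzero polynomial in the entries of $T$) the matrix $T$ is nonsingular and $p^T$ is good. 3. Let $T$ be nonsingular with $\tilde p:=p^T$ good. Then $h_{\tilde p}$ has a zero. For each zero $s$ of $h_{\tilde p}$, put $t=-\bigl(\sum_{i=0}^{n-1}\tilde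 p_{i,n-1-i}s^i\bigr)/h_{\tilde p}'(s)$ and let $S$ be the matrix of the shift $x=\tilde x+s\tilde y+t\tilde z$, $y=\tilde y$, $z=\tilde z$. Then $\tilde p^{\,S}$ is good and is an admissible input. For every ordering of the zeros of $v_{\tilde p^{\,S}}$, apply the algorithm to $\tilde p^{\,S}$ and undo the substitutions $S$ and $T$ in the homogeneous pencil $zA+xB+yC$; the result is a determinantal representation of $p$ of order $n$. In particular, every square-free $p$ of degree $n$ has a determinantal representation of order $n$ constructed in this way. 4. In general $p=p_1\cdots p_k$ for some square-free polynomials $p_i$ of degrees $d_i\ge1$. For every such factorization, $d_1+\cdots+d_k=n$, the construction in 3 can be carried out for each $p_i$, and for every run of it, with output $A_i,B_i,C_i\in\mathbb C^{d_i\times d_i}$, the block-diagonal matrices $\operatorname{diag}(A_1,\dots,A_k)$, $\operatorname{diag}(B_1,\dots,B_k)$, $\operatorname{diag}(C_1,\dots,C_k)$ form a determinantal representation of $p$ of order $n$. Consequently every bivariate polynomial $p$ of degree $n\ge1$ has a determinantal representation of order $n$. This order is minimal: every determinantal representation of $p$ has order at least $n$. -/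

import Mathlib

namespace DetRep

noncomputable section

/-- Bivariate complex polynomials; `x` is the variable `0` and `y` is the variable `1`. -/
abbrev Poly : Type := MvPolynomial (Fin 2) ℂ

/-- The variable `x`. -/
def x : Poly := MvPolynomial.X 0

/-- The variable `y`. -/
def y : Poly := MvPolynomial.X 1

/-- The coefficient `p_{ij}` of `x ^ i * y ^ j` in `p`. -/
def cf (p : Poly) (i j : ℕ) : ℂ :=
  MvPolynomial.coeff (Finsupp.single 0 i + Finsupp.single 1 j) p

/-- The three coefficient matrices of a linear matrix pencil `A + x B + y C` of order `m`. -/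
@[ext]
structure Pencil (m : ℕ) where
  A : Matrix (Fin m) (Fin m) ℂ
  B : Matrix (Fin m) (Fin m) ℂ
  C : Matrix (Fin m) (Fin m) ℂ

/-- `A, B, C` form a determinantal representation of `p`: `det (A + x B + y C) = p`. -/
def IsDetRep {m : ℕ} (p : Poly) (M : Pencil m) : Prop :=
  (M.A.map MvPolynomial.C + x • M.B.map MvPolynomial.C
    + y • M.C.map MvPolynomial.C : Matrix (Fin m) (Fin m) Poly).det = p

/-! ### Homogenization and linear substitutions -/

/-- `p_h(x, y, z) = ∑_{i + j ≤ n} p_{ij} x^i y^j z^{n-i-j}`. -/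
def homogenize (n : ℕ) (p : Poly) : MvPolynomial (Fin 3) ℂ :=
  ∑ i ∈ Finset.range (n + 1), ∑ j ∈ Finset.range (n + 1 - i),
    MvPolynomial.C (cf p i j) * MvPolynomial.X 0 ^ i * MvPolynomial.X 1 ^ j
      * MvPolynomial.X 2 ^ (n - i - j)

/-- Setting `z = 1`. -/
def dehomogenize (F : MvPolynomial (Fin 3) ℂ) : Poly :=
  MvPolynomial.aeval ![x, y, 1] F

/-- The substitution `(x, y, z)ᵀ = T (x', y', z')ᵀ` in a ternary polynomial. -/
def linSubst (T : Matrix (Fin 3) (Fin 3) ℂ) (F : MvPolynomial (Fin 3) ℂ) :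
    MvPolynomial (Fin 3) ℂ :=
  MvPolynomial.aeval (fun i => ∑ j, MvPolynomial.C (T i j) * MvPolynomial.X j) F

/-- The bivariate polynomial of the homogeneous form `p_h ∘ T`. -/
def transform (n : ℕ) (T : Matrix (Fin 3) (Fin 3) ℂ) (p : Poly) : Poly :=
  dehomogenize (linSubst T (homogenize n p))

/-- Given matrices with `det (z' A + x' B + y' C) = (p_h ∘ T)(x', y', z')`, substitute
`(x', y', z')ᵀ = T⁻¹ (x, y, z)ᵀ` in the pencil `z' A + x' B + y' C`, and collect the coefficients
of `z`, `x` and `y`. -/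
def pullback {n : ℕ} (T : Matrix (Fin 3) (Fin 3) ℂ) (M : Pencil n) : Pencil n where
  A := T⁻¹ 0 2 • M.B + T⁻¹ 1 2 • M.C + T⁻¹ 2 2 • M.A
  B := T⁻¹ 0 0 • M.B + T⁻¹ 1 0 • M.C + T⁻¹ 2 0 • M.A
  C := T⁻¹ 0 1 • M.B + T⁻¹ 1 1 • M.C + T⁻¹ 2 1 • M.A

/-! ### Normal forms -/

/-- All zeros of a univariate polynomial are simple. -/
def SimpleRoots (f : Polynomial ℂ) : Prop :=
  ∀ ζ, f.IsRoot ζ → f.rootMultiplicity ζ = 1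

/-- `h(ξ) = p_h(ξ, 1, 0) = p_{n0} ξ^n + p_{n-1,1} ξ^{n-1} + ⋯ + p_{0n}`. -/
def topPoly (n : ℕ) (p : Poly) : Polynomial ℂ :=
  ∑ i ∈ Finset.range (n + 1), Polynomial.C (cf p i (n - i)) * Polynomial.X ^ i

/-- `v(ξ) = p_{n0} ξ^{n-1} + p_{n-1,1} ξ^{n-2} + ⋯ + p_{1,n-1}`. -/
def vPoly (n : ℕ) (p : Poly) : Polynomial ℂ :=
  ∑ i ∈ Finset.range n, Polynomial.C (cf p (i + 1) (n - 1 - i)) * Polynomial.X ^ i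

/-- `p` has degree `n`, `p_{n0} ≠ 0`, and all zeros of `h(ξ) = p_h(ξ, 1, 0)` are simple. -/
structure IsGood (n : ℕ) (p : Poly) : Prop where
  degree : p.totalDegree = n
  lead : cf p n 0 ≠ 0
  simple : SimpleRoots (topPoly n p)

/-- The conditions on the input of the algorithm. -/
structure IsAlgInput (n : ℕ) (p : Poly) : Prop where
  degree : p.totalDegree = n
  lead : cf p n 0 ≠ 0
  simple : SimpleRoots (vPoly n p)
  nonzero : ∀ ζ, (vPoly n p).IsRoot ζ → ζ ≠ 0
  vanish : cf p 0 n = 0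
  vanish' : cf p 0 (n - 1) = 0

/-- The number `t` that goes with a zero `s` of `h`. -/
def shiftT (n : ℕ) (p : Poly) (s : ℂ) : ℂ :=
  -(∑ i ∈ Finset.range n, cf p i (n - 1 - i) * s ^ i) / (topPoly n p).derivative.eval s

/-- The matrix of the substitution `x = x' + s y' + t z'`, `y = y'`, `z = z'`, with `t`
determined by `s`. -/
def shiftMatrix (n : ℕ) (p : Poly) (s : ℂ) : Matrix (Fin 3) (Fin 3) ℂ :=
  !![1, s, shiftT n p s; 0, 1, 0; 0, 0, 1]

/-! ### The algorithm -/

/-- The list `ξ 1, …, ξ (n - 1)` enumerates the zeros of `v` (with multiplicities). Values of `ξ`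
outside `1, …, n - 1` play no role. -/
def Enumerates (n : ℕ) (p : Poly) (ξ : ℕ → ℂ) : Prop :=
  (Finset.Icc 1 (n - 1)).val.map ξ = (vPoly n p).roots

/-- The polynomials `q_j` (for coefficients `f_{jℓ}` supported on `ℓ ≤ k`):
`q_0 = 1` and `q_j = ∑_{ℓ=1}^{min(j,k)} f_{jℓ} q_{j-ℓ}`. -/
def qPoly (f : ℕ → ℕ → Poly) (k : ℕ) : ℕ → Poly
  | 0 => 1
  | j + 1 => ∑ l : Fin (min (j + 1) k), f (j + 1) ((l : ℕ) + 1) * qPoly f k (j - (l : ℕ))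
  termination_by j => j
  decreasing_by omega

/-- The data held by the algorithm: `α l` is `α_{n-1,l}` (the other `α_{jl}` are `1`), `β j l` is
`β_{jl}`, `γ j` is `γ_j`, and `r` is the current residual. -/
structure State where
  α : ℕ → ℂ
  β : ℕ → ℕ → ℂ
  γ : ℕ → ℂ
  r : Poly

/-- `f_{jl} = α_{jl} x + β_{jl} y`, with `α_{jl} = 1` for `j ≠ n - 1`. -/
def lin (n : ℕ) (α : ℕ → ℂ) (β : ℕ → ℕ → ℂ) (j l : ℕ) : Poly :=
  MvPolynomial.C (if j = n - 1 then α l else 1) * x + MvPolynomial.C (β j l) * y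

/-- Before the loop: `f_{j1} = x - ξ_j y`, and `r = p - p_{n0} x q_{n-1}`. -/
def initState (n : ℕ) (p : Poly) (ξ : ℕ → ℂ) : State :=
  let α : ℕ → ℂ := fun l => if l = 1 then 1 else 0
  let β : ℕ → ℕ → ℂ := fun j l => if l = 1 then -ξ j else 0
  { α := α
    β := β
    γ := fun _ => 0
    r := p - MvPolynomial.C (cf p n 0) * x * qPoly (lin n α β) 1 (n - 1) }

/-- `h(t) = (r_{n-k+1,0} t^{n-k} + r_{n-k,1} t^{n-k-1} + ⋯ + r_{1,n-k}) / p_{n0}`. -/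
def hPoly (n : ℕ) (p : Poly) (k : ℕ) (r : Poly) : Polynomial ℂ :=
  ∑ i ∈ Finset.range (n - k + 1),
    Polynomial.C (cf r (i + 1) (n - k - i) / cf p n 0) * Polynomial.X ^ i

/-- `α_{n-1,k} = r_{n-k+1,0} / p_{n0} - n + k + 1`. -/
def newAlpha (n : ℕ) (p : Poly) (k : ℕ) (r : Poly) : ℂ :=
  cf r (n - k + 1) 0 / cf p n 0 - n + k + 1

/-- `g(t) = h(t) - t ∑_{ℓ=k}^{n-2} ∏_{i=1}^{ℓ-k} (t - ξ_i) ∏_{j=ℓ+1}^{n-1} (t - ξ_j)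
  - α_{n-1,k} t ∏_{i=1}^{n-k-1} (t - ξ_i)`. -/
def gPoly (n : ℕ) (p : Poly) (ξ : ℕ → ℂ) (k : ℕ) (r : Poly) : Polynomial ℂ :=
  hPoly n p k r
    - Polynomial.X * ∑ l ∈ Finset.Icc k (n - 2),
        (∏ i ∈ Finset.Icc 1 (l - k), (Polynomial.X - Polynomial.C (ξ i)))
          * ∏ j ∈ Finset.Icc (l + 1) (n - 1), (Polynomial.X - Polynomial.C (ξ j))
    - Polynomial.C (newAlpha n p k r) * Polynomial.X
        * ∏ i ∈ Finset.Icc 1 (n - k - 1), (Polynomial.X - Polynomial.C (ξ i))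

/-- The lower triangular matrix of the linear system, with the entries
`w_{mℓ} = ∏_{i=1}^{ℓ-1} (ξ_m - ξ_i) ∏_{j=ℓ+k}^{n-1} (ξ_m - ξ_j)` for `ℓ ≤ m`; the
(zero-based) indices `m`, `l` below stand for `m + 1`, `l + 1`. -/
def wMatrix (n : ℕ) (ξ : ℕ → ℂ) (k : ℕ) : Matrix (Fin (n - k)) (Fin (n - k)) ℂ :=
  Matrix.of fun m l =>
    if l ≤ m then
      (∏ i ∈ Finset.Icc 1 (l : ℕ), (ξ ((m : ℕ) + 1) - ξ i))
        * ∏ j ∈ Finset.Icc (l + 1 + k : ℕ) (n - 1), (ξ ((m : ℕ) + 1) - ξ j)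
    else 0

/-- The solution `(β_{kk}, β_{k+1,k}, …, β_{n-1,k})` of the linear system with right-hand side
`(g(ξ_1), …, g(ξ_{n-k}))`. -/
def newBeta (n : ℕ) (p : Poly) (ξ : ℕ → ℂ) (k : ℕ) (r : Poly) : Fin (n - k) → ℂ :=
  (wMatrix n ξ k)⁻¹.mulVec fun m => (gPoly n p ξ k r).eval (ξ ((m : ℕ) + 1))

/-- The `k`-th step of the main loop. -/
def step (n : ℕ) (p : Poly) (ξ : ℕ → ℂ) (k : ℕ) (S : State) : State :=
  let α : ℕ → ℂ := Function.update S.α k (newAlpha n p k S.r)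
  let β : ℕ → ℕ → ℂ := fun j l =>
    if l = k then
      if hj : k ≤ j ∧ j - k < n - k then newBeta n p ξ k S.r ⟨j - k, hj.2⟩ else 0
    else S.β j l
  let q : ℕ → Poly := qPoly (lin n α β) k
  let s : Poly := p - MvPolynomial.C (cf p n 0) * x * q (n - 1)
    - ∑ l ∈ Finset.Icc 2 (k - 1), MvPolynomial.C (S.γ (n - l)) * q (n - l)
  let c : ℂ := (-1) ^ (n - k) * cf s 0 (n - k) / ∏ i ∈ Finset.Icc 1 (n - k), ξ i
  { α := α
    β := β
    γ := Function.update S.γ (n - k) c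
    r := s - MvPolynomial.C c * q (n - k) }

/-- The state after the steps `k = 2, …, m + 1`. -/
def loop (n : ℕ) (p : Poly) (ξ : ℕ → ℂ) : ℕ → State
  | 0 => initState n p ξ
  | m + 1 => step n p ξ (m + 2) (loop n p ξ m)

/-- The output of the algorithm, read off from the state after the steps `k = 2, …, n - 1`.
(For `n = 1` the places `(1, 1)` and `(1, n)` coincide; their contributions are added.) -/
def algorithm (n : ℕ) (p : Poly) (ξ : ℕ → ℂ) : Pencil n :=
  let S := loop n p ξ (n - 2)
  { A := Matrix.of fun i j =>
      if (i : ℕ) = 0 then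
        if (j : ℕ) = 0 then cf S.r 0 0 else if (j : ℕ) < n - 1 then S.γ j else 0
      else if i = j then 1 else 0
    B := Matrix.of fun i j =>
      if (i : ℕ) = 0 then
        (if (j : ℕ) = 0 then cf S.r 1 0 else 0) + (if (j : ℕ) = n - 1 then cf p n 0 else 0)
      else if j < i then -(if (i : ℕ) = n - 1 then S.α ((i : ℕ) - (j : ℕ)) else 1) else 0
    C := Matrix.of fun i j => if j < i then -S.β i ((i : ℕ) - (j : ℕ)) else 0 }

/-! ### The whole construction -/

/-- `p` after the substitution `T` and after the shift that belongs to `s`. -/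
def normalForm (n : ℕ) (p : Poly) (T : Matrix (Fin 3) (Fin 3) ℂ) (s : ℂ) : Poly :=
  transform n (shiftMatrix n (transform n T p) s) (transform n T p)

/-- Substitute `T`, shift by means of `s`, apply the algorithm with the zeros `ξ`, and substitute
back. -/
def construction (n : ℕ) (p : Poly) (T : Matrix (Fin 3) (Fin 3) ℂ) (s : ℂ) (ξ : ℕ → ℂ) :
    Pencil n :=
  pullback T (pullback (shiftMatrix n (transform n T p) s) (algorithm n (normalForm n p T s) ξ))

/-- Choices with which the construction can be run: `T` is nonsingular, it brings `p` to a form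
with `p_{n0} ≠ 0` and simple zeros of `h`, `s` is one of these zeros, and `ξ` enumerates the zeros
of `v` after the shift. -/
structure IsAdmissible (n : ℕ) (p : Poly) (T : Matrix (Fin 3) (Fin 3) ℂ) (s : ℂ) (ξ : ℕ → ℂ) :
    Prop where
  nonsingular : T.det ≠ 0
  good : IsGood n (transform n T p)
  root : (topPoly n (transform n T p)).IsRoot s
  enumerates : Enumerates n (normalForm n p T s) ξ

/-- `diag (M_1, …, M_k)`, with rows and columns numbered consecutively. -/
def blockDiag {k n : ℕ} {d : Fin k → ℕ} (hd : ∑ i, d i = n)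
    (M : ∀ i, Matrix (Fin (d i)) (Fin (d i)) ℂ) : Matrix (Fin n) (Fin n) ℂ :=
  Matrix.reindex (finSigmaFinEquiv.trans (finCongr hd)) (finSigmaFinEquiv.trans (finCongr hd))
    (Matrix.blockDiagonal' M)

/-- The pencil of the block-diagonal matrices. -/
def blockPencil {k n : ℕ} {d : Fin k → ℕ} (hd : ∑ i, d i = n) (M : ∀ i, Pencil (d i)) :
    Pencil n where
  A := blockDiag hd fun i => (M i).A
  B := blockDiag hd fun i => (M i).B
  C := blockDiag hd fun i => (M i).C

/-- `p = f_1 ⋯ f_k` with square-free factors `f_i` of degrees `d_i ≥ 1`. -/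
structure IsSquarefreeFactorization {k : ℕ} (p : Poly) (f : Fin k → Poly) (d : Fin k → ℕ) :
    Prop where
  prod_eq : ∏ i, f i = p
  squarefree : ∀ i, Squarefree (f i)
  degree : ∀ i, (f i).totalDegree = d i
  pos : ∀ i, 1 ≤ d i

end

end DetRep

namespace DetRep

open MvPolynomial

noncomputable section

/-! Below its first row the pencil is unit lower triangular, and these rows annihilate the vector
`(q_0, …, q_{n-1})` because they encode the recursion for `q_j`. Hence the determinant is the first
row times this vector, that is `r_00 + r_10 x + ∑ γ_j q_j + p_{n0} x q_{n-1}`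
(`det_eq_of_hessenberg`). The algorithm has to choose the `f_{jℓ}` and `γ_j` so that this equals
`p`.

It does so by lowering the degree of the residual by one in each step. Switching on the coefficients
`f_{lk}` changes `q_{n-1}` only in degrees at most `n - k`, with an explicit leading form linear in
them (`qPoly_succ_sub_sub_headChange_mem`). The residual contains no pure power of `y` in its top
degree, so its leading form is divisible by `x`. Matching it becomes a univariate problem after
setting `y = 1`: the `α` fixes the leading coefficient, and the `β` interpolate at `n - k` distinct
zeros `ξ_i` (`hPoly_eq_sum`). Since the `ξ_i` are nonzero, `q_{n-k}` contains `y ^ (n - k)`, and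
`γ_{n-k}` removes this power from the new residual. At the end only `r_00 + r_10 x` is left
(`loopInvariant_step`, `isDetRep_algorithm`).

Substitutions are undone on the level of forms, where the determinant of the homogeneous pencil is a
form of degree equal to its order; this also gives minimality. The shift moves a simple zero of `h`
to `0`, so that `h = ξ v` has simple zeros exactly when those of `v` are simple and nonzero, while
`t` cancels the coefficient of `y ^ (n - 1)`. For square-free `p` the discriminant of `h` is not
identically zero in `T`: by Gauss's lemma some line `y = v` meets the curve in `n` distinct points,
and this line can be moved to infinity (`genericityPoly_ne_zero`). The general case follows by
factoring into irreducibles and taking block-diagonal matrices. -/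

lemma homogeneous_induction {σ : Type*} {n : ℕ} {P : MvPolynomial σ ℂ → Prop} (h0 : P 0)
    (hadd : ∀ a b, P a → P b → P (a + b))
    (hmon : ∀ (e : σ →₀ ℕ) (c : ℂ), e.degree = n → P (monomial e c))
    {F : MvPolynomial σ ℂ} (hF : F.IsHomogeneous n) : P F := by
  rw [F.as_sum]
  refine Finset.sum_induction _ P hadd h0 fun e he => hmon e _ ?_
  by_contra h
  exact (mem_support_iff.mp he) (hF.coeff_eq_zero h)

/-! ### Coefficients -/

lemma exponent_eq (e : Fin 2 →₀ ℕ) :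
    (Finsupp.single 0 (e 0) + Finsupp.single 1 (e 1) : Fin 2 →₀ ℕ) = e := by
  ext i; fin_cases i <;> simp

lemma exponent_degree (i j : ℕ) :
    (Finsupp.single 0 i + Finsupp.single 1 j : Fin 2 →₀ ℕ).degree = i + j := by
  simp

lemma exponent_inj {i j a b : ℕ} :
    (Finsupp.single 0 i + Finsupp.single 1 j : Fin 2 →₀ ℕ)
      = Finsupp.single 0 a + Finsupp.single 1 b ↔ i = a ∧ j = b := by
  constructor
  · intro h
    exact ⟨by simpa using DFunLike.congr_fun h 0, by simpa using DFunLike.congr_fun h 1⟩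
  · rintro ⟨rfl, rfl⟩; rfl

lemma cf_add (a b : Poly) (i j : ℕ) : cf (a + b) i j = cf a i j + cf b i j := by simp [cf]
lemma cf_sub (a b : Poly) (i j : ℕ) : cf (a - b) i j = cf a i j - cf b i j := by simp [cf]
lemma cf_C_mul (c : ℂ) (a : Poly) (i j : ℕ) : cf (C c * a) i j = c * cf a i j := by simp [cf]
lemma cf_zero (i j : ℕ) : cf 0 i j = 0 := by simp [cf]

lemma cf_monomial (e : Fin 2 →₀ ℕ) (c : ℂ) (i j : ℕ) :
    cf (monomial e c) i j = if e 0 = i ∧ e 1 = j then c else 0 := by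
  classical
  rw [cf, coeff_monomial]
  conv_lhs => rw [← exponent_eq e]
  simp only [exponent_inj]

lemma ext_cf {a b : Poly} (h : ∀ i j, cf a i j = cf b i j) : a = b := by
  ext e
  rw [← exponent_eq e]
  exact h _ _

lemma monomial_eq_xy (e : Fin 2 →₀ ℕ) (c : ℂ) :
    (monomial e c : Poly) = C c * x ^ e 0 * y ^ e 1 := by
  rw [monomial_eq, Finsupp.prod_fintype _ _ (by simp), Fin.prod_univ_two, x, y, mul_assoc]

lemma cf_C_mul_x_pow_mul_y_pow (c : ℂ) (a b i j : ℕ) :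
    cf (C c * x ^ a * y ^ b) i j = if a = i ∧ b = j then c else 0 := by
  have := monomial_eq_xy (Finsupp.single 0 a + Finsupp.single 1 b) c
  simp at this
  rw [← this, cf_monomial]
  simp

/-! ### Polynomials of degree less than `d` -/

/-- The polynomials all of whose monomials have degree less than `d`. -/
def degLT (d : ℕ) : Submodule ℂ Poly where
  carrier := {a | ∀ i j, d ≤ i + j → cf a i j = 0}
  add_mem' ha hb i j h := by rw [cf_add, ha i j h, hb i j h, add_zero]
  zero_mem' i j _ := cf_zero i j
  smul_mem' c a ha i j h := by rw [smul_eq_C_mul, cf_C_mul, ha i j h, mul_zero]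

lemma mem_degLT {d : ℕ} {a : Poly} : a ∈ degLT d ↔ ∀ i j, d ≤ i + j → cf a i j = 0 := Iff.rfl

lemma degLT_mono {d e : ℕ} (h : d ≤ e) : degLT d ≤ degLT e :=
  fun _ ha i j hij => ha i j (h.trans hij)

lemma mem_degLT_succ {d : ℕ} {a : Poly} : a ∈ degLT (d + 1) ↔ a.totalDegree ≤ d := by
  have key : ∀ e : Fin 2 →₀ ℕ, (e.sum fun _ m => m) = e 0 + e 1 := fun e => by
    rw [Finsupp.sum_fintype _ _ (by simp), Fin.sum_univ_two]
  simp only [totalDegree, Finset.sup_le_iff, key]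
  constructor
  · intro h e he
    by_contra hlt
    rw [mem_support_iff, ← exponent_eq e] at he
    exact he (h _ _ (by omega))
  · intro h i j hij
    by_contra hne
    have := h _ (mem_support_iff.mpr hne)
    simp at this
    omega

lemma mem_degLT_zero {a : Poly} : a ∈ degLT 0 ↔ a = 0 :=
  ⟨fun h => ext_cf fun i j => by rw [h i j (Nat.zero_le _), cf_zero], fun h => h ▸ zero_mem _⟩

lemma mul_mem_degLT {d e : ℕ} {a b : Poly} (ha : a ∈ degLT (d + 1)) (hb : b ∈ degLT e) :
    a * b ∈ degLT (d + e) := by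
  cases e with
  -- `degLT 0` contains only the zero polynomial, a bound that `totalDegree` cannot express.
  | zero => rw [mem_degLT_zero.mp hb, mul_zero]; exact zero_mem _
  | succ e =>
    rw [mem_degLT_succ] at ha hb
    rw [← add_assoc, mem_degLT_succ]
    exact (totalDegree_mul _ _).trans (add_le_add ha hb)

lemma C_mul_mem_degLT {d : ℕ} (c : ℂ) {a : Poly} (ha : a ∈ degLT d) : C c * a ∈ degLT d := by
  rw [← smul_eq_C_mul]; exact Submodule.smul_mem _ _ ha

lemma _root_.MvPolynomial.IsHomogeneous.mem_degLT {d : ℕ} {a : Poly} (ha : a.IsHomogeneous d) :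
    a ∈ degLT (d + 1) := mem_degLT_succ.mpr ha.totalDegree_le

/-! ### Leading forms -/

lemma topPoly_coeff (d : ℕ) (a : Poly) (i : ℕ) :
    (topPoly d a).coeff i = if i ≤ d then cf a i (d - i) else 0 := by
  simp [topPoly, Polynomial.coeff_C_mul, Polynomial.coeff_X_pow]

lemma vPoly_coeff (n : ℕ) (a : Poly) (i : ℕ) :
    (vPoly n a).coeff i = if i < n then cf a (i + 1) (n - 1 - i) else 0 := by
  simp [vPoly, Polynomial.coeff_C_mul, Polynomial.coeff_X_pow]

lemma topPoly_add (d : ℕ) (a b : Poly) : topPoly d (a + b) = topPoly d a + topPoly d b := by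
  ext i; simp only [topPoly_coeff, Polynomial.coeff_add, cf_add]; split_ifs <;> simp

lemma topPoly_sub (d : ℕ) (a b : Poly) : topPoly d (a - b) = topPoly d a - topPoly d b := by
  ext i; simp only [topPoly_coeff, Polynomial.coeff_sub, cf_sub]; split_ifs <;> simp

lemma topPoly_natDegree_le (d : ℕ) (a : Poly) : (topPoly d a).natDegree ≤ d := by
  rw [Polynomial.natDegree_le_iff_coeff_eq_zero]
  intro i hi
  rw [topPoly_coeff, if_neg (by omega)]

lemma topPoly_eq_zero_of_mem {d : ℕ} {a : Poly} (ha : a ∈ degLT d) : topPoly d a = 0 := by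
  ext i
  rw [topPoly_coeff, Polynomial.coeff_zero]
  split_ifs with h
  · exact ha _ _ (by omega)
  · rfl

/-- Every drop of degree in the algorithm is obtained this way: leading forms are compared as
univariate polynomials. -/
lemma mem_degLT_of_topPoly_eq_zero {d : ℕ} {a : Poly} (ha : a ∈ degLT (d + 1))
    (h : topPoly d a = 0) : a ∈ degLT d := by
  intro i j hij
  rcases hij.lt_or_eq with hlt | heq
  · exact ha i j hlt
  · have := topPoly_coeff d a i
    rw [h, Polynomial.coeff_zero, if_pos (by omega)] at this
    rw [this]; congr; omega

/-- The substitution `x = X`, `y = 1`. -/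
def dehomogenizeY : Poly →ₐ[ℂ] Polynomial ℂ := aeval ![Polynomial.X, 1]

@[simp] lemma dehomogenizeY_x : dehomogenizeY x = Polynomial.X := by simp [dehomogenizeY, x]
@[simp] lemma dehomogenizeY_y : dehomogenizeY y = 1 := by simp [dehomogenizeY, y]
@[simp] lemma dehomogenizeY_C (c : ℂ) : dehomogenizeY (C c) = Polynomial.C c := by
  simp [dehomogenizeY, Polynomial.algebraMap_eq]

/-- In general `topPoly d` is only linear. On forms of degree `d` it agrees with an algebra
homomorphism, so products of linear forms can be evaluated factor by factor. -/
lemma topPoly_of_isHomogeneous {d : ℕ} {a : Poly} (ha : a.IsHomogeneous d) :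
    topPoly d a = dehomogenizeY a := by
  refine homogeneous_induction (P := fun a => topPoly d a = dehomogenizeY a) ?_ ?_ ?_ ha
  · rw [topPoly_eq_zero_of_mem (zero_mem _), map_zero]
  · intro a b ha hb; rw [topPoly_add, ha, hb, map_add]
  · intro e c he
    have he' : e 0 + e 1 = d := by rw [← he]; conv_rhs => rw [← exponent_eq e, exponent_degree]
    ext i
    rw [monomial_eq_xy, topPoly_coeff, cf_C_mul_x_pow_mul_y_pow]
    simp only [map_mul, map_pow, dehomogenizeY_C, dehomogenizeY_x, dehomogenizeY_y, one_pow,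
      mul_one, Polynomial.coeff_C_mul, Polynomial.coeff_X_pow]
    by_cases h : i = e 0
    · rw [if_pos (by omega), if_pos (by omega), if_pos h, mul_one]
    · rw [if_neg h, mul_zero]
      split_ifs with h1 h2 <;> [omega; rfl; rfl]

lemma topPoly_eq_X_mul_vPoly {n : ℕ} {a : Poly} (h : cf a 0 n = 0) :
    topPoly n a = Polynomial.X * vPoly n a := by
  ext i
  cases i with
  | zero => simp [topPoly_coeff, h]
  | succ i =>
    rw [Polynomial.coeff_X_mul, topPoly_coeff, vPoly_coeff]
    simp only [Nat.succ_le_iff, Nat.sub_add_eq, Nat.sub_right_comm]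

/-! ### Homogenization -/

lemma homogenize_eq_sum_range (n : ℕ) (p : Poly) : homogenize n p =
    ∑ i ∈ Finset.range (n + 1), ∑ j ∈ Finset.range (n + 1 - i),
      monomial (Finsupp.single 0 i + Finsupp.single 1 j + Finsupp.single 2 (n - i - j))
        (cf p i j) := by
  refine Finset.sum_congr rfl fun i _ => Finset.sum_congr rfl fun j _ => ?_
  rw [monomial_eq, Finsupp.prod_fintype _ _ (by simp), Fin.prod_univ_three]
  simp [mul_assoc]

lemma homogenize_isHomogeneous (n : ℕ) (p : Poly) : (homogenize n p).IsHomogeneous n := by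
  rw [homogenize_eq_sum_range]
  refine IsHomogeneous.sum _ _ _ fun i hi => IsHomogeneous.sum _ _ _ fun j hj => ?_
  refine isHomogeneous_monomial _ ?_
  simp only [Finset.mem_range] at hi hj
  simp only [map_add, Finsupp.degree_single]
  omega

lemma homogenize_add (n : ℕ) (p q : Poly) :
    homogenize n (p + q) = homogenize n p + homogenize n q := by
  simp only [homogenize_eq_sum_range, cf_add, map_add, Finset.sum_add_distrib]

lemma homogenize_zero (n : ℕ) : homogenize n 0 = 0 := by
  simp [homogenize_eq_sum_range, cf_zero]

lemma homogenize_C_mul_x_pow_mul_y_pow {n i j : ℕ} (h : i + j ≤ n) (c : ℂ) :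
    homogenize n (C c * x ^ i * y ^ j) = C c * X 0 ^ i * X 1 ^ j * X 2 ^ (n - i - j) := by
  rw [homogenize, Finset.sum_eq_single i, Finset.sum_eq_single j]
  · rw [cf_C_mul_x_pow_mul_y_pow, if_pos ⟨rfl, rfl⟩]
  · intro b _ hb
    rw [cf_C_mul_x_pow_mul_y_pow, if_neg (by omega)]; simp
  · intro hb; simp at hb; omega
  · intro b _ hb
    refine Finset.sum_eq_zero fun c _ => ?_
    rw [cf_C_mul_x_pow_mul_y_pow, if_neg (by omega)]; simp
  · intro hb; simp at hb; omega

/-- Setting `z = 1`, as an algebra homomorphism. -/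
def dehomogenizeHom : MvPolynomial (Fin 3) ℂ →ₐ[ℂ] Poly := aeval ![x, y, 1]

lemma dehomogenize_eq (F : MvPolynomial (Fin 3) ℂ) : dehomogenize F = dehomogenizeHom F := rfl

/-- Forms of a fixed degree are thus determined by their values at `z = 1`. Composition of
substitutions and their inversion in the pencil rest on this. -/
lemma homogenize_dehomogenize {n : ℕ} {F : MvPolynomial (Fin 3) ℂ} (hF : F.IsHomogeneous n) :
    homogenize n (dehomogenize F) = F := by
  simp only [dehomogenize_eq]
  refine homogeneous_induction (P := fun F => homogenize n (dehomogenizeHom F) = F) ?_ ?_ ?_ hF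
  · rw [map_zero, homogenize_zero]
  · intro a b ha hb; rw [map_add, homogenize_add, ha, hb]
  · intro e c he
    have he' : e 0 + e 1 + e 2 = n := by
      rw [← he, Finsupp.degree_eq_sum, Fin.sum_univ_three]
    rw [monomial_eq, Finsupp.prod_fintype _ _ (by simp), Fin.prod_univ_three]
    have : dehomogenizeHom (C c * (X 0 ^ e 0 * X 1 ^ e 1 * X 2 ^ e 2))
        = C c * x ^ e 0 * y ^ e 1 := by
      simp [dehomogenizeHom, algebraMap_eq, mul_assoc]
    rw [this, homogenize_C_mul_x_pow_mul_y_pow (by omega)]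
    simp only [mul_assoc]
    congr; omega

lemma poly_eq_sum_range {n : ℕ} {p : Poly} (hp : p ∈ degLT (n + 1)) : p =
    ∑ i ∈ Finset.range (n + 1), ∑ j ∈ Finset.range (n + 1 - i), C (cf p i j) * x ^ i * y ^ j := by
  refine ext_cf fun i j => ?_
  have hsum : ∀ (s : Finset ℕ) (f : ℕ → Poly), cf (∑ a ∈ s, f a) i j = ∑ a ∈ s, cf (f a) i j :=
    fun s f => by simp [cf, coeff_sum]
  simp only [hsum, cf_C_mul_x_pow_mul_y_pow]
  by_cases h : i + j ≤ n
  · rw [Finset.sum_eq_single i, Finset.sum_eq_single j, if_pos ⟨rfl, rfl⟩]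
    · intro b _ hb; rw [if_neg (by omega)]
    · intro hb; simp at hb; omega
    · intro b _ hb; exact Finset.sum_eq_zero fun c _ => by rw [if_neg (by omega)]
    · intro hb; simp at hb; omega
  · rw [hp i j (by omega)]
    refine (Finset.sum_eq_zero fun a ha => Finset.sum_eq_zero fun b hb => ?_).symm
    simp only [Finset.mem_range] at ha hb
    rw [if_neg (by omega)]

lemma dehomogenize_homogenize {n : ℕ} {p : Poly} (hp : p.totalDegree ≤ n) :
    dehomogenize (homogenize n p) = p := by
  conv_rhs => rw [poly_eq_sum_range (mem_degLT_succ.mpr hp)]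
  simp [dehomogenize_eq, dehomogenizeHom, homogenize, algebraMap_eq]

lemma totalDegree_dehomogenize_le {n : ℕ} {F : MvPolynomial (Fin 3) ℂ} (hF : F.IsHomogeneous n) :
    (dehomogenize F).totalDegree ≤ n := by
  rw [← mem_degLT_succ]
  simp only [dehomogenize_eq]
  refine homogeneous_induction (P := fun F => dehomogenizeHom F ∈ degLT (n + 1)) ?_ ?_ ?_ hF
  · rw [map_zero]; exact zero_mem _
  · intro a b ha hb; rw [map_add]; exact add_mem ha hb
  · intro e c he i j hij
    have he' : e 0 + e 1 + e 2 = n := by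
      rw [← he, Finsupp.degree_eq_sum, Fin.sum_univ_three]
    rw [monomial_eq, Finsupp.prod_fintype _ _ (by simp), Fin.prod_univ_three]
    have : dehomogenizeHom (C c * (X 0 ^ e 0 * X 1 ^ e 1 * X 2 ^ e 2))
        = C c * x ^ e 0 * y ^ e 1 := by
      simp [dehomogenizeHom, algebraMap_eq, mul_assoc]
    rw [this, cf_C_mul_x_pow_mul_y_pow, if_neg (by omega)]

lemma topPoly_eq_aeval_homogenize (n : ℕ) (p : Poly) :
    topPoly n p = aeval ![Polynomial.X, 1, 0] (homogenize n p) := by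
  simp only [homogenize, map_sum, map_mul, map_pow, aeval_X, aeval_C, topPoly]
  refine Finset.sum_congr rfl fun i hi => ?_
  simp only [Finset.mem_range] at hi
  rw [Finset.sum_eq_single (n - i)]
  · simp [Polynomial.algebraMap_eq]
  · intro j hj hne
    simp only [Finset.mem_range] at hj
    have : n - i - j ≠ 0 := by omega
    simp [this]
  · intro hb; simp at hb; omega

/-! ### The recursion for `q_j` -/

lemma qPoly_zero (f : ℕ → ℕ → Poly) (k : ℕ) : qPoly f k 0 = 1 := by rw [qPoly]

lemma qPoly_succ (f : ℕ → ℕ → Poly) (k j : ℕ) :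
    qPoly f k (j + 1) =
      ∑ l ∈ Finset.range (min (j + 1) k), f (j + 1) (l + 1) * qPoly f k (j - l) := by
  rw [qPoly, Finset.sum_range]

/-- Coefficients with second index beyond `k` do not enter, so a later step that fills in a new
diagonal leaves the earlier `q_j` intact. -/
lemma qPoly_congr {f g : ℕ → ℕ → Poly} {k : ℕ} (h : ∀ j l, l ≤ k → f j l = g j l) (j : ℕ) :
    qPoly f k j = qPoly g k j := by
  induction j using Nat.strong_induction_on with
  | _ j ih =>
    cases j with
    | zero => rw [qPoly_zero, qPoly_zero]
    | succ j =>
      rw [qPoly_succ, qPoly_succ]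
      refine Finset.sum_congr rfl fun l hl => ?_
      rw [Finset.mem_range] at hl
      rw [h _ _ (by omega), ih _ (by omega)]

/-- The leading form `f_{11} ⋯ f_{j1}` of `q_j`. -/
def headProd (f : ℕ → ℕ → Poly) (j : ℕ) : Poly := ∏ a ∈ Finset.Icc 1 j, f a 1

/-- The leading form of the change of `q_j` caused by the coefficients `f_{lk}`. -/
def headChange (f : ℕ → ℕ → Poly) (k j : ℕ) : Poly :=
  ∑ l ∈ Finset.Icc k j, f l k * (headProd f (l - k) * ∏ a ∈ Finset.Icc (l + 1) j, f a 1)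

lemma headProd_succ (f : ℕ → ℕ → Poly) (j : ℕ) :
    headProd f (j + 1) = f (j + 1) 1 * headProd f j := by
  rw [headProd, Finset.prod_Icc_succ_top (by omega), mul_comm, headProd]

lemma headChange_succ (f : ℕ → ℕ → Poly) {k j : ℕ} (h : k ≤ j + 1) :
    headChange f k (j + 1) =
      f (j + 1) 1 * headChange f k j + f (j + 1) k * headProd f (j + 1 - k) := by
  rw [headChange, Finset.sum_Icc_succ_top h, headChange, Finset.mul_sum]
  refine congrArg₂ (· + ·) (Finset.sum_congr rfl fun l hl => ?_) ?_
  · rw [Finset.mem_Icc] at hl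
    rw [Finset.prod_Icc_succ_top (by omega)]
    ring
  · rw [Finset.Icc_eq_empty (by omega), Finset.prod_empty, mul_one]

lemma headProd_isHomogeneous {f : ℕ → ℕ → Poly} (hf : ∀ j l, (f j l).IsHomogeneous 1) (j : ℕ) :
    (headProd f j).IsHomogeneous j := by
  rw [headProd]
  simpa using IsHomogeneous.prod (Finset.Icc 1 j) (fun a => f a 1) (fun _ => 1) fun a _ => hf a 1

lemma headChange_isHomogeneous {f : ℕ → ℕ → Poly} (hf : ∀ j l, (f j l).IsHomogeneous 1)
    (k i : ℕ) : (headChange f k (k + i)).IsHomogeneous (i + 1) := by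
  refine IsHomogeneous.sum _ _ _ fun l hl => ?_
  rw [Finset.mem_Icc] at hl
  have h := (hf l k).mul ((headProd_isHomogeneous hf (l - k)).mul
    (IsHomogeneous.prod (Finset.Icc (l + 1) (k + i)) (fun a => f a 1) (fun _ => 1)
      fun a _ => hf a 1))
  simp only [Finset.sum_const, Nat.card_Icc, smul_eq_mul, mul_one] at h
  have e : 1 + (l - k + (k + i + 1 - (l + 1))) = i + 1 := by omega
  rwa [e] at h

section

variable {f : ℕ → ℕ → Poly} (hf : ∀ j l, (f j l).IsHomogeneous 1)
include hf

/-- A summand with index `ℓ` gains one degree but lowers the index of `q` by `ℓ`. Full degree `j`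
therefore survives only if `ℓ = 1` is used throughout. -/
lemma qPoly_sub_headProd_mem {k : ℕ} (hk : 1 ≤ k) (j : ℕ) :
    qPoly f k j - headProd f j ∈ degLT j := by
  induction j using Nat.strong_induction_on with
  | _ j ih =>
    cases j with
    | zero => simp [qPoly_zero, headProd]
    | succ j =>
      obtain ⟨m, hm⟩ : ∃ m, min (j + 1) k = m + 1 := ⟨min (j + 1) k - 1, by omega⟩
      rw [qPoly_succ, hm, Finset.sum_range_succ', headProd_succ, add_sub_assoc]
      refine add_mem (Submodule.sum_mem _ fun l hl => ?_) ?_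
      · rw [Finset.mem_range] at hl
        have h1 : qPoly f k (j - (l + 1)) ∈ degLT (j - l) := by
          have := add_mem (degLT_mono (by omega : _ ≤ j - l) (ih (j - (l + 1)) (by omega)))
            (degLT_mono (by omega : _ ≤ j - l) (headProd_isHomogeneous hf (j - (l + 1))).mem_degLT)
          simpa using this
        exact degLT_mono (by omega : 1 + (j - l) ≤ j + 1) (mul_mem_degLT (hf _ _).mem_degLT h1)
      · rw [Nat.sub_zero, zero_add, ← mul_sub, add_comm j 1]
        exact mul_mem_degLT (hf _ _).mem_degLT (ih j (by omega))

lemma qPoly_mem {k : ℕ} (hk : 1 ≤ k) (j : ℕ) : qPoly f k j ∈ degLT (j + 1) := by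
  simpa using add_mem (degLT_mono (Nat.le_succ j) (qPoly_sub_headProd_mem hf hk j))
    (headProd_isHomogeneous hf j).mem_degLT

-- For `j ≤ k` the recursion never reaches a coefficient with second index `k + 1`.
omit hf in
lemma qPoly_succ_sub_eq_zero (f : ℕ → ℕ → Poly) {k j : ℕ} (hj : j ≤ k) :
    qPoly f (k + 1) j - qPoly f k j = 0 := by
  induction j using Nat.strong_induction_on with
  | _ j ih =>
    cases j with
    | zero => simp [qPoly_zero]
    | succ j =>
      rw [qPoly_succ, qPoly_succ, min_eq_left (by omega), min_eq_left hj,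
        ← Finset.sum_sub_distrib]
      refine Finset.sum_eq_zero fun l _ => ?_
      rw [← mul_sub, ih _ (by omega) (by omega), mul_zero]

/-- Each use of some `f_{l,k+1}` costs `k` degrees. In `q_{k+1+i}` a single use, with `ℓ = 1`
everywhere else, gives degree `i + 1`; these contributions make up `headChange`, and all others have
smaller degree. The induction subtracts the two recursions and separates the summands `ℓ = 1`, `2 ≤
ℓ ≤ k` and `ℓ = k + 1`. -/
lemma qPoly_succ_sub_sub_headChange_mem {k : ℕ} (hk : 1 ≤ k) (i : ℕ) :
    qPoly f (k + 1) (k + 1 + i) - qPoly f k (k + 1 + i) - headChange f (k + 1) (k + 1 + i)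
      ∈ degLT (i + 1) := by
  induction i using Nat.strong_induction_on with
  | _ i ih =>
    have hD : ∀ l < i, qPoly f (k + 1) (k + 1 + l) - qPoly f k (k + 1 + l) ∈ degLT (l + 2) :=
      fun l hl => by
        simpa using add_mem (degLT_mono (Nat.le_succ _) (ih l hl))
          (headChange_isHomogeneous hf (k + 1) l).mem_degLT
    obtain ⟨m, rfl⟩ : ∃ m, k = m + 1 := ⟨k - 1, by omega⟩
    have e : m + 1 + 1 + i = (m + 1 + i) + 1 := by omega
    have hq := qPoly_sub_headProd_mem hf (by omega : 1 ≤ m + 1 + 1) i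
    rw [e, qPoly_succ, qPoly_succ, headChange_succ _ (by omega), min_eq_right (by omega),
      min_eq_right (by omega), Finset.sum_range_succ, Finset.sum_range_succ',
      Finset.sum_range_succ']
    simp only [Nat.sub_zero, zero_add]
    rw [show m + 1 + i - (m + 1) = i by omega, show m + 1 + i + 1 - (m + 1 + 1) = i by omega]
    -- The summands `2 ≤ ℓ ≤ k`: the index has dropped by at least two, so the crude bound `hD` is
    -- enough.
    have h1 : ∑ l ∈ Finset.range m, f (m + 1 + i + 1) (l + 1 + 1)
          * qPoly f (m + 1 + 1) (m + 1 + i - (l + 1))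
        - ∑ l ∈ Finset.range m, f (m + 1 + i + 1) (l + 1 + 1)
          * qPoly f (m + 1) (m + 1 + i - (l + 1)) ∈ degLT (i + 1) := by
      rw [← Finset.sum_sub_distrib]
      refine Submodule.sum_mem _ fun l hl => ?_
      rw [← mul_sub]
      by_cases h : l + 1 < i
      · have := hD (i - (l + 1) - 1) (by omega)
        rw [show m + 1 + 1 + (i - (l + 1) - 1) = m + 1 + i - (l + 1) by omega] at this
        exact degLT_mono (by omega : 1 + (i - (l + 1) - 1 + 2) ≤ i + 1)
          (mul_mem_degLT (hf _ _).mem_degLT this)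
      · rw [qPoly_succ_sub_eq_zero f (by omega), mul_zero]
        exact zero_mem _
    -- The summand `ℓ = 1` carries the leading form along. It needs the induction hypothesis itself,
    -- except for `i = 0`, where nothing has changed yet.
    have h2 : f (m + 1 + i + 1) 1 * (qPoly f (m + 1 + 1) (m + 1 + i) - qPoly f (m + 1) (m + 1 + i)
        - headChange f (m + 1 + 1) (m + 1 + i)) ∈ degLT (i + 1) := by
      -- The bound is split as `1 + i`: one degree for the linear factor, less than `i` for the
      -- rest.
      rw [add_comm i 1]
      refine mul_mem_degLT (hf _ _).mem_degLT ?_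
      cases i with
      | zero =>
        rw [qPoly_succ_sub_eq_zero f (by omega), headChange, Finset.Icc_eq_empty (by omega)]
        simp
      | succ i =>
        have := ih i (by omega)
        rwa [show m + 1 + 1 + i = m + 1 + (i + 1) by omega] at this
    have h3 : f (m + 1 + i + 1) (m + 1 + 1) * (qPoly f (m + 1 + 1) i - headProd f i)
        ∈ degLT (i + 1) := by
      rw [add_comm i 1]
      exact mul_mem_degLT (hf _ _).mem_degLT hq
    convert add_mem (add_mem h1 h2) h3 using 1
    ring

lemma qPoly_succ_sub_mem {k : ℕ} (hk : 1 ≤ k) (i : ℕ) :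
    qPoly f (k + 1) (k + 1 + i) - qPoly f k (k + 1 + i) ∈ degLT (i + 2) := by
  simpa using add_mem (degLT_mono (Nat.le_succ _) (qPoly_succ_sub_sub_headChange_mem hf hk i))
    (headChange_isHomogeneous hf (k + 1) i).mem_degLT

end

/-! ### The determinant of the pencil -/

/-- The vector `q` is mapped to a multiple of the first unit vector. Applying the adjugate and
reading off entry `0` gives `det M` on one side, as `q 0 = 1`, and on the other that multiple times
the complementary minor, which is unitriangular. No division is needed, so polynomial entries are
allowed. -/
lemma det_eq_of_hessenberg {R : Type*} [CommRing R] {n : ℕ}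
    (M : Matrix (Fin (n + 1)) (Fin (n + 1)) R) (q : Fin (n + 1) → R) (h0 : q 0 = 1)
    (hdiag : ∀ i, i ≠ 0 → M i i = 1) (hupper : ∀ i j, i ≠ 0 → i < j → M i j = 0)
    (hq : ∀ i, i ≠ 0 → ∑ j, M i j * q j = 0) : M.det = ∑ j, M 0 j * q j := by
  have hMq : M.mulVec q = Pi.single 0 (∑ j, M 0 j * q j) := by
    ext i
    by_cases hi : i = 0
    · subst hi; simp [Matrix.mulVec, dotProduct]
    · rw [Pi.single_eq_of_ne hi]
      exact hq i hi
  have h := congrArg (fun v => M.adjugate.mulVec v 0) hMq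
  simp only [Matrix.mulVec_mulVec, Matrix.adjugate_mul, Matrix.smul_mulVec, Matrix.one_mulVec,
    Pi.smul_apply, h0, smul_eq_mul, mul_one] at h
  rw [h, Matrix.mulVec_single, Pi.smul_apply, Matrix.col_apply,
    Matrix.adjugate_fin_succ_eq_det_submatrix]
  have htri : (M.submatrix Fin.succ Fin.succ).det = 1 := by
    rw [Matrix.det_of_isLowerTriangular]
    · exact Finset.prod_eq_one fun i _ => hdiag _ (Fin.succ_ne_zero i)
    · intro i j hij
      exact hupper _ _ (Fin.succ_ne_zero i) (Fin.succ_lt_succ_iff.mpr hij)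
  simp [htri]

/-! ### The linear system of a step -/

/-- The cofactor of `f_{lk}` in the leading form of the change of `q_{n-1}`, with `y = 1`. -/
def wPoly (n : ℕ) (ξ : ℕ → ℂ) (k l : ℕ) : Polynomial ℂ :=
  (∏ i ∈ Finset.Icc 1 (l - k), (Polynomial.X - Polynomial.C (ξ i)))
    * ∏ j ∈ Finset.Icc (l + 1) (n - 1), (Polynomial.X - Polynomial.C (ξ j))

/-- The numbers `β_{lk}` computed in step `k`, extended by zero. -/
def newBetaFun (n : ℕ) (p : Poly) (ξ : ℕ → ℂ) (k : ℕ) (r : Poly) (l : ℕ) : ℂ :=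
  if hj : k ≤ l ∧ l - k < n - k then newBeta n p ξ k r ⟨l - k, hj.2⟩ else 0

section

variable {n k : ℕ} {ξ : ℕ → ℂ}

lemma wPoly_monic (l : ℕ) : (wPoly n ξ k l).Monic :=
  (Polynomial.monic_prod_X_sub_C _ _).mul (Polynomial.monic_prod_X_sub_C _ _)

lemma wPoly_natDegree {l : ℕ} (hkl : k ≤ l) (hl : l < n) :
    (wPoly n ξ k l).natDegree = n - k - 1 := by
  rw [wPoly, (Polynomial.monic_prod_X_sub_C _ _).natDegree_mul
    (Polynomial.monic_prod_X_sub_C _ _), Polynomial.natDegree_finsetProd_X_sub_C_eq_card,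
    Polynomial.natDegree_finsetProd_X_sub_C_eq_card, Nat.card_Icc, Nat.card_Icc]
  omega

/-- The triangular system is the interpolation system for the polynomials `wPoly` at the nodes `ξ_1,
…, ξ_{n-k}`: the zeros above the diagonal are actual values. -/
lemma wMatrix_apply (m l : Fin (n - k)) :
    wMatrix n ξ k m l = (wPoly n ξ k (k + l)).eval (ξ (m + 1)) := by
  simp only [wMatrix, Matrix.of_apply, wPoly, Polynomial.eval_mul, Polynomial.eval_prod,
    Polynomial.eval_sub, Polynomial.eval_X, Polynomial.eval_C]
  rw [show k + (l : ℕ) - k = l by omega, show k + (l : ℕ) + 1 = l + 1 + k by omega]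
  split_ifs with h
  · rfl
  -- For `m < l` the first product contains the factor `ξ (m + 1) - ξ (m + 1)`.
  · rw [Finset.prod_eq_zero (i := (m : ℕ) + 1), zero_mul]
    · rw [Finset.mem_Icc]; exact ⟨by omega, by omega⟩
    · rw [sub_self]

lemma wMatrix_det_ne_zero (hk : 1 ≤ k) (hξ : Set.InjOn ξ (Set.Icc 1 (n - 1))) :
    (wMatrix n ξ k).det ≠ 0 := by
  have hne : ∀ a b, 1 ≤ a → a ≤ n - 1 → 1 ≤ b → b ≤ n - 1 → a ≠ b → ξ a - ξ b ≠ 0 :=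
    fun a b h1 h2 h3 h4 h5 h => h5 (hξ ⟨h1, h2⟩ ⟨h3, h4⟩ (sub_eq_zero.mp h))
  rw [Matrix.det_of_isLowerTriangular]
  · refine Finset.prod_ne_zero_iff.mpr fun m _ => ?_
    simp only [wMatrix, Matrix.of_apply, le_refl, if_true]
    refine mul_ne_zero (Finset.prod_ne_zero_iff.mpr fun i hi => ?_)
      (Finset.prod_ne_zero_iff.mpr fun i hi => ?_)
    all_goals
      rw [Finset.mem_Icc] at hi
      have := m.2
      exact hne _ _ (by omega) (by omega) (by omega) (by omega) (by omega)
  · intro i j hij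
    have : ¬ j ≤ i := not_le.mpr hij
    simp [wMatrix, this]

lemma hPoly_coeff (p r : Poly) (i : ℕ) : (hPoly n p k r).coeff i =
    if i ≤ n - k then cf r (i + 1) (n - k - i) / cf p n 0 else 0 := by
  simp [hPoly, Polynomial.coeff_C_mul, Polynomial.coeff_X_pow]

lemma gPoly_eq (hk : k < n) (hn : 2 ≤ n) (p r : Poly) : gPoly n p ξ k r = hPoly n p k r
    - ∑ l ∈ Finset.Icc k (n - 1),
      Polynomial.C (if l = n - 1 then newAlpha n p k r else 1) * Polynomial.X * wPoly n ξ k l := by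
  obtain ⟨m, rfl⟩ : ∃ m, n = m + 2 := ⟨n - 2, by omega⟩
  rw [show m + 2 - 1 = m + 1 by omega, Finset.sum_Icc_succ_top (by omega), gPoly, sub_sub,
    Finset.mul_sum]
  refine congrArg (hPoly (m + 2) p k r - ·) (congrArg₂ (· + ·) ?_ ?_)
  · rw [show m + 2 - 2 = m by omega]
    refine Finset.sum_congr rfl fun l hl => ?_
    rw [Finset.mem_Icc] at hl
    rw [if_neg (by omega), map_one, one_mul, wPoly]
  · rw [if_pos rfl, wPoly, Finset.Icc_eq_empty (a := m + 1 + 1) (by omega), Finset.prod_empty,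
      mul_one, show m + 2 - k - 1 = m + 1 - k by omega]

lemma sum_Icc_eq_sum_fin (hk : k < n) (F : ℕ → ℂ) :
    ∑ l ∈ Finset.Icc k (n - 1), F l = ∑ i : Fin (n - k), F (k + i) := by
  have : Finset.Icc k (n - 1) = Finset.Ico k n := by ext; simp; omega
  rw [this, Finset.sum_Ico_eq_sum_range, Finset.sum_range]

/-- The right-hand side is the cofactor form of the change of `q_{n-1}` at `y = 1`, so this says
that step `k` can match the leading form of the residual. The discrepancy `E` has degree below `n -
k` by the choice of `α`, and vanishes at `n - k` distinct points by the choice of the `β`. -/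
lemma hPoly_eq_sum (hk1 : 1 ≤ k) (hk : k < n) (hn : 2 ≤ n)
    (hξ : Set.InjOn ξ (Set.Icc 1 (n - 1))) (p r : Poly) :
    hPoly n p k r = ∑ l ∈ Finset.Icc k (n - 1),
      (Polynomial.C (if l = n - 1 then newAlpha n p k r else 1) * Polynomial.X
        + Polynomial.C (newBetaFun n p ξ k r l)) * wPoly n ξ k l := by
  set E := gPoly n p ξ k r
    - ∑ l ∈ Finset.Icc k (n - 1), Polynomial.C (newBetaFun n p ξ k r l) * wPoly n ξ k l with hE
  suffices h : E = 0 by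
    rw [hE, gPoly_eq hk hn, sub_sub, ← Finset.sum_add_distrib] at h
    rw [sub_eq_zero.mp h]
    exact Finset.sum_congr rfl fun l _ => by ring
  have hcoeff : ∀ i, n - k ≤ i → E.coeff i = 0 := by
    intro i hi
    have hw0 : ∀ l ∈ Finset.Icc k (n - 1), (wPoly n ξ k l).coeff i = 0 := fun l hl => by
      rw [Finset.mem_Icc] at hl
      exact Polynomial.coeff_eq_zero_of_natDegree_lt
        (by rw [wPoly_natDegree hl.1 (by omega)]; omega)
    have hw1 : ∀ l ∈ Finset.Icc k (n - 1),
        (Polynomial.X * wPoly n ξ k l).coeff i = if i = n - k then 1 else 0 := fun l hl => by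
      rw [Finset.mem_Icc] at hl
      obtain ⟨i, rfl⟩ : ∃ j, i = j + 1 := ⟨i - 1, by omega⟩
      have hd := wPoly_natDegree (ξ := ξ) hl.1 (by omega : l < n)
      rw [Polynomial.coeff_X_mul]
      split_ifs with h
      · rw [show i = (wPoly n ξ k l).natDegree by omega]
        exact wPoly_monic l
      · exact Polynomial.coeff_eq_zero_of_natDegree_lt (by omega)
    -- Each `X * wPoly n ξ k l` is monic of degree `n - k`, so the leading coefficient is the sum of
    -- the `α`'s. Of these `n - 1 - k` equal `1`, which explains the constant in `newAlpha`.
    have hsum : ∑ l ∈ Finset.Icc k (n - 1), (if l = n - 1 then newAlpha n p k r else 1)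
        = cf r (n - k + 1) 0 / cf p n 0 := by
      obtain ⟨m, rfl⟩ : ∃ m, n = m + 1 := ⟨n - 1, by omega⟩
      obtain ⟨m, rfl⟩ : ∃ j, m = j + 1 := ⟨m - 1, by omega⟩
      rw [show m + 1 + 1 - 1 = m + 1 by omega, Finset.sum_Icc_succ_top (by omega), if_pos rfl,
        Finset.sum_congr rfl (g := fun _ => (1 : ℂ)) fun l hl => by
          rw [Finset.mem_Icc] at hl; rw [if_neg (by omega)]]
      rw [Finset.sum_const, Nat.card_Icc, newAlpha, nsmul_eq_mul,
        Nat.cast_sub (by omega : k ≤ m + 1)]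
      push_cast
      ring
    rw [hE, gPoly_eq hk hn, Polynomial.coeff_sub, Polynomial.coeff_sub,
      Polynomial.finsetSum_coeff, Polynomial.finsetSum_coeff]
    simp only [mul_assoc, Polynomial.coeff_C_mul]
    have h0 : ∑ l ∈ Finset.Icc k (n - 1), newBetaFun n p ξ k r l * (wPoly n ξ k l).coeff i = 0 :=
      Finset.sum_eq_zero fun l hl => by rw [hw0 l hl, mul_zero]
    rw [h0, Finset.sum_congr rfl fun l hl => by rw [hw1 l hl], ← Finset.sum_mul, hsum, hPoly_coeff]
    by_cases h : i = n - k
    · subst h; simp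
    · rw [if_neg (by omega), if_neg h]; simp
  refine Polynomial.eq_zero_of_degree_lt_of_eval_finset_eq_zero
    ((Finset.Icc 1 (n - k)).image ξ) ?_ ?_
  · rw [Finset.card_image_of_injOn, Nat.card_Icc, Nat.add_sub_cancel]
    · exact (Polynomial.degree_lt_iff_coeff_zero _ _).mpr hcoeff
    · refine hξ.mono fun i hi => ?_
      rw [Finset.mem_coe, Finset.mem_Icc] at hi
      exact ⟨hi.1, by omega⟩
  · intro z hz
    obtain ⟨m, hm, rfl⟩ := Finset.mem_image.mp hz
    rw [Finset.mem_Icc] at hm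
    obtain ⟨m, rfl⟩ : ∃ j, m = j + 1 := ⟨m - 1, by omega⟩
    have hsol : (wMatrix n ξ k).mulVec (newBeta n p ξ k r)
        = fun m : Fin (n - k) => (gPoly n p ξ k r).eval (ξ ((m : ℕ) + 1)) := by
      unfold newBeta
      rw [Matrix.mulVec_mulVec, Matrix.mul_nonsing_inv, Matrix.one_mulVec]
      exact isUnit_iff_ne_zero.mpr (wMatrix_det_ne_zero hk1 hξ)
    have h := congrFun hsol ⟨m, by omega⟩
    simp only [Matrix.mulVec, dotProduct, wMatrix_apply] at h
    rw [hE, Polynomial.eval_sub, ← h, Polynomial.eval_finsetSum, sum_Icc_eq_sum_fin hk,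
      sub_eq_zero]
    refine Finset.sum_congr rfl fun i _ => ?_
    rw [newBetaFun, dif_pos ⟨by omega, by omega⟩, Polynomial.eval_mul, Polynomial.eval_C, mul_comm]
    congr
    exact Fin.ext (Nat.add_sub_cancel_left _ _).symm

end

/-! ### The loop -/

lemma lin_isHomogeneous (n : ℕ) (α : ℕ → ℂ) (β : ℕ → ℕ → ℂ) (j l : ℕ) :
    (lin n α β j l).IsHomogeneous 1 :=
  (isHomogeneous_C_mul_X _ _).add (isHomogeneous_C_mul_X _ _)

lemma dehomogenizeY_lin (n : ℕ) (α : ℕ → ℂ) (β : ℕ → ℕ → ℂ) (j l : ℕ) :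
    dehomogenizeY (lin n α β j l) =
      Polynomial.C (if j = n - 1 then α l else 1) * Polynomial.X + Polynomial.C (β j l) := by
  simp [lin]

section

variable {n : ℕ} {α : ℕ → ℂ} {β : ℕ → ℕ → ℂ} {ξ : ℕ → ℂ} (hα : α 1 = 1) (hβ : ∀ j, β j 1 = -ξ j)
include hα hβ

lemma dehomogenizeY_lin_one (j : ℕ) :
    dehomogenizeY (lin n α β j 1) = Polynomial.X - Polynomial.C (ξ j) := by
  rw [dehomogenizeY_lin, hα, hβ]
  simp [sub_eq_add_neg]

lemma dehomogenizeY_headProd (j : ℕ) : dehomogenizeY (headProd (lin n α β) j)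
    = ∏ i ∈ Finset.Icc 1 j, (Polynomial.X - Polynomial.C (ξ i)) := by
  rw [headProd, map_prod]
  exact Finset.prod_congr rfl fun i _ => dehomogenizeY_lin_one hα hβ i

lemma dehomogenizeY_headChange (k : ℕ) : dehomogenizeY (headChange (lin n α β) k (n - 1))
    = ∑ l ∈ Finset.Icc k (n - 1),
      (Polynomial.C (if l = n - 1 then α k else 1) * Polynomial.X + Polynomial.C (β l k))
        * wPoly n ξ k l := by
  rw [headChange, map_sum]
  refine Finset.sum_congr rfl fun l _ => ?_
  rw [map_mul, map_mul, dehomogenizeY_lin, dehomogenizeY_headProd hα hβ, map_prod, wPoly]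
  exact congrArg _ (congrArg _ (Finset.prod_congr rfl fun i _ => dehomogenizeY_lin_one hα hβ i))

/-- Only the leading form `∏ (x - ξ_i y)` contributes to this coefficient. It is the denominator, up
to sign, in the formula for `γ_{n-k}`. -/
lemma cf_qPoly {k : ℕ} (hk : 1 ≤ k) (j : ℕ) :
    cf (qPoly (lin n α β) k j) 0 j = (-1) ^ j * ∏ i ∈ Finset.Icc 1 j, ξ i := by
  have h1 := qPoly_sub_headProd_mem (lin_isHomogeneous n α β) hk j 0 j (by omega)
  rw [cf_sub, sub_eq_zero] at h1
  have h2 := topPoly_coeff j (headProd (lin n α β) j) 0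
  rw [topPoly_of_isHomogeneous (headProd_isHomogeneous (lin_isHomogeneous n α β) j),
    dehomogenizeY_headProd hα hβ, if_pos (Nat.zero_le _), Nat.sub_zero,
    Polynomial.coeff_zero_eq_eval_zero, Polynomial.eval_prod] at h2
  rw [h1, ← h2]
  simp only [Polynomial.eval_sub, Polynomial.eval_X, Polynomial.eval_C, zero_sub,
    Finset.prod_neg, Nat.card_Icc, Nat.add_sub_cancel]

end

/-- The state after the steps `2, …, k`: the leading terms of the `q_j` are known, and `r` is the
residual, which has degree at most `n - k` and does not contain `y ^ (n - k)`. -/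
structure LoopInvariant (n : ℕ) (p : Poly) (ξ : ℕ → ℂ) (k : ℕ) (S : State) : Prop where
  alpha : S.α 1 = 1
  beta : ∀ j, S.β j 1 = -ξ j
  residual : S.r = p - C (cf p n 0) * x * qPoly (lin n S.α S.β) k (n - 1)
    - ∑ l ∈ Finset.Icc 2 k, C (S.γ (n - l)) * qPoly (lin n S.α S.β) k (n - l)
  degree : S.r ∈ degLT (n - k + 1)
  vanish : cf S.r 0 (n - k) = 0

lemma vPoly_natDegree_le (n : ℕ) (p : Poly) : (vPoly n p).natDegree ≤ n - 1 := by
  rw [Polynomial.natDegree_le_iff_coeff_eq_zero]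
  intro i hi
  rw [vPoly_coeff, if_neg (by omega)]

lemma vPoly_leadingCoeff {n : ℕ} (hn : 1 ≤ n) {p : Poly} (h : cf p n 0 ≠ 0) :
    (vPoly n p).natDegree = n - 1 ∧ (vPoly n p).leadingCoeff = cf p n 0 := by
  have hc : (vPoly n p).coeff (n - 1) = cf p n 0 := by
    rw [vPoly_coeff, if_pos (by omega), Nat.sub_self, Nat.sub_add_cancel hn]
  have hd : (vPoly n p).natDegree = n - 1 :=
    (vPoly_natDegree_le n p).antisymm (Polynomial.le_natDegree_of_ne_zero (by rwa [hc]))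
  exact ⟨hd, by rw [Polynomial.leadingCoeff, hd, hc]⟩

lemma Enumerates.vPoly_eq {n : ℕ} (hn : 1 ≤ n) {p : Poly} (h : cf p n 0 ≠ 0) {ξ : ℕ → ℂ}
    (hξ : Enumerates n p ξ) : vPoly n p =
      Polynomial.C (cf p n 0) * ∏ i ∈ Finset.Icc 1 (n - 1), (Polynomial.X - Polynomial.C (ξ i)) := by
  rw [(IsAlgClosed.splits (vPoly n p)).eq_prod_roots, ← hξ, (vPoly_leadingCoeff hn h).2,
    Multiset.map_map]
  rfl

lemma Enumerates.injOn {n : ℕ} {p : Poly} (h : SimpleRoots (vPoly n p)) {ξ : ℕ → ℂ}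
    (hξ : Enumerates n p ξ) : Set.InjOn ξ (Set.Icc 1 (n - 1)) := by
  have hnd : (vPoly n p).roots.Nodup := by
    rw [Multiset.nodup_iff_count_le_one]
    intro a
    rw [Polynomial.count_roots]
    by_cases ha : (vPoly n p).IsRoot a
    · exact (h a ha).le
    · rw [Polynomial.rootMultiplicity_eq_zero ha]; exact Nat.zero_le _
  rw [← hξ] at hnd
  intro a ha b hb hab
  exact Multiset.inj_on_of_nodup_map hnd a (by simpa using ha) b (by simpa using hb) hab

lemma Enumerates.isRoot {n : ℕ} {p : Poly} {ξ : ℕ → ℂ} (hξ : Enumerates n p ξ) {i : ℕ}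
    (hi : i ∈ Finset.Icc 1 (n - 1)) : (vPoly n p).IsRoot (ξ i) := by
  refine Polynomial.isRoot_of_mem_roots ?_
  rw [← hξ]
  exact Multiset.mem_map_of_mem ξ hi

section

variable {n : ℕ} {p : Poly} {ξ : ℕ → ℂ} (hn : 1 ≤ n) (hp : IsAlgInput n p)
  (hξ : Enumerates n p ξ)
include hn hp hξ

lemma loopInvariant_initState : LoopInvariant n p ξ 1 (initState n p ξ) := by
  have hα : (initState n p ξ).α 1 = 1 := by simp [initState]
  have hβ : ∀ j, (initState n p ξ).β j 1 = -ξ j := fun j => by simp [initState]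
  have hr : (initState n p ξ).r = p - C (cf p n 0) * x
      * qPoly (lin n (initState n p ξ).α (initState n p ξ).β) 1 (n - 1) := rfl
  -- With one diagonal there are no lower terms: `q_j` equals its leading form.
  have hq : ∀ j, qPoly (lin n (initState n p ξ).α (initState n p ξ).β) 1 j
      = headProd (lin n (initState n p ξ).α (initState n p ξ).β) j := fun j => by
    induction j with
    | zero => simp [qPoly_zero, headProd]
    | succ j ih => rw [qPoly_succ, headProd_succ]; simp [ih]
  have hhom : (C (cf p n 0) * x
      * qPoly (lin n (initState n p ξ).α (initState n p ξ).β) 1 (n - 1)).IsHomogeneous n := by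
    have := (isHomogeneous_C_mul_X (cf p n 0) (0 : Fin 2)).mul
      (headProd_isHomogeneous (lin_isHomogeneous n (initState n p ξ).α (initState n p ξ).β) (n - 1))
    rw [hq]
    rwa [show 1 + (n - 1) = n by omega] at this
  refine ⟨hα, hβ, by rw [hr]; simp, ?_, ?_⟩
  · rw [Nat.sub_add_cancel hn, hr]
    refine mem_degLT_of_topPoly_eq_zero
      (sub_mem (mem_degLT_succ.mpr hp.degree.le) hhom.mem_degLT) ?_
    rw [topPoly_sub, topPoly_of_isHomogeneous hhom, hq, topPoly_eq_X_mul_vPoly hp.vanish,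
      hξ.vPoly_eq hn hp.lead, map_mul, map_mul, dehomogenizeY_headProd hα hβ]
    simp only [dehomogenizeY_C, dehomogenizeY_x]
    ring
  -- The subtracted term is a form of degree `n`, so the coefficient of `y ^ (n - 1)` is that of
  -- `p`.
  · rw [hr, cf_sub, hp.vanish', zero_sub, neg_eq_zero]
    exact hhom.coeff_eq_zero (by rw [exponent_degree]; omega)

/-- The new residual differs from the old one by the change of `p_{n0} x q_{n-1}`, by changes of the
terms with `γ`, which have lower degree, and by the new term with `γ_{n-k-1}`. The first cancels the
leading form; the last removes the remaining power of `y`. -/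
lemma loopInvariant_step {k : ℕ} (hk : 1 ≤ k) (hkn : k + 1 < n) {S : State}
    (hS : LoopInvariant n p ξ k S) : LoopInvariant n p ξ (k + 1) (step n p ξ (k + 1) S) := by
  set S' := step n p ξ (k + 1) S with hS'
  have hα' : S'.α = Function.update S.α (k + 1) (newAlpha n p (k + 1) S.r) := rfl
  have hβ' : ∀ j l, S'.β j l = if l = k + 1 then newBetaFun n p ξ (k + 1) S.r j else S.β j l :=
    fun _ _ => rfl
  have hα : S'.α 1 = 1 := by rw [hα', Function.update_of_ne (by omega), hS.alpha]
  have hβ : ∀ j, S'.β j 1 = -ξ j := fun j => by rw [hβ', if_neg (by omega), hS.beta]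
  set f := lin n S'.α S'.β with hf
  have hfh : ∀ j l, (f j l).IsHomogeneous 1 := lin_isHomogeneous n S'.α S'.β
  have hold : ∀ j, qPoly (lin n S.α S.β) k j = qPoly f k j := qPoly_congr fun j l hl => by
    rw [hf, lin, lin, hα', hβ', Function.update_of_ne (by omega),
      if_neg (by omega : ¬ l = k + 1)]
  set s : Poly := p - C (cf p n 0) * x * qPoly f (k + 1) (n - 1)
    - ∑ l ∈ Finset.Icc 2 k, C (S.γ (n - l)) * qPoly f (k + 1) (n - l) with hs
  set c : ℂ := (-1) ^ (n - (k + 1)) * cf s 0 (n - (k + 1)) / ∏ i ∈ Finset.Icc 1 (n - (k + 1)), ξ i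
    with hc
  have hγ' : S'.γ = Function.update S.γ (n - (k + 1)) c := rfl
  have hr' : S'.r = s - C c * qPoly f (k + 1) (n - (k + 1)) := rfl
  -- Now `n - 1 = (k + 1) + N`, the shape of index in which the change of `q_{n-1}` was computed.
  obtain ⟨N, rfl⟩ : ∃ N, n = k + 1 + N + 1 := ⟨n - (k + 2), by omega⟩
  have e1 : k + 1 + N + 1 - 1 = k + 1 + N := by omega
  have e2 : k + 1 + N + 1 - (k + 1) = N + 1 := by omega
  have e3 : k + 1 + N + 1 - k = N + 2 := by omega
  have hhom : (C (cf p (k + 1 + N + 1) 0) * x * headChange f (k + 1) (k + 1 + N)).IsHomogeneous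
      (N + 2) := by
    have := (isHomogeneous_C_mul_X (cf p (k + 1 + N + 1) 0) (0 : Fin 2)).mul
      (headChange_isHomogeneous hfh (k + 1) N)
    rwa [show 1 + (N + 1) = N + 2 by omega] at this
  have hmain : S.r - C (cf p (k + 1 + N + 1) 0) * x * headChange f (k + 1) (k + 1 + N)
      ∈ degLT (N + 2) := by
    have hd := hS.degree
    have hv := hS.vanish
    rw [e3] at hd hv
    refine mem_degLT_of_topPoly_eq_zero (sub_mem hd hhom.mem_degLT) ?_
    -- Since `y ^ (N + 2)` is absent from the residual, its leading form is divisible by `x`, and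
    -- `hPoly` is the quotient by `p_{n0} x`.
    have htop : topPoly (N + 2) S.r = Polynomial.C (cf p (k + 1 + N + 1) 0) * Polynomial.X
        * hPoly (k + 1 + N + 1) p (k + 1) S.r := by
      ext i
      rw [topPoly_coeff, mul_assoc, Polynomial.coeff_C_mul]
      cases i with
      | zero => simp [hv]
      | succ i =>
        rw [Polynomial.coeff_X_mul, hPoly_coeff, e2, show N + 2 - (i + 1) = N + 1 - i by omega]
        by_cases h : i ≤ N + 1
        · rw [if_pos (by omega), if_pos h, mul_div_cancel₀ _ hp.lead]
        · rw [if_neg (by omega), if_neg h, mul_zero]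
    have hchange := dehomogenizeY_headChange (n := k + 1 + N + 1) hα hβ (k + 1)
    rw [e1] at hchange
    rw [topPoly_sub, topPoly_of_isHomogeneous hhom, htop, map_mul, map_mul, dehomogenizeY_C,
      dehomogenizeY_x, hchange, hPoly_eq_sum (ξ := ξ) (by omega) (by omega) (by omega)
      (hξ.injOn hp.simple), e1, sub_eq_zero]
    refine congrArg _ (Finset.sum_congr rfl fun l _ => ?_)
    rw [hβ', if_pos rfl, hα', Function.update_self]
  have hsmem : s ∈ degLT (N + 2) := by
    have h1 : C (cf p (k + 1 + N + 1) 0) * x * (qPoly f (k + 1) (k + 1 + N)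
        - qPoly f k (k + 1 + N) - headChange f (k + 1) (k + 1 + N)) ∈ degLT (N + 2) :=
      degLT_mono (by omega : 1 + (N + 1) ≤ N + 2) (mul_mem_degLT
        (isHomogeneous_C_mul_X _ _).mem_degLT (qPoly_succ_sub_sub_headChange_mem hfh hk N))
    have h2 : ∑ l ∈ Finset.Icc 2 k, C (S.γ (k + 1 + N + 1 - l))
        * (qPoly f (k + 1) (k + 1 + N + 1 - l) - qPoly f k (k + 1 + N + 1 - l))
          ∈ degLT (N + 2) := by
      refine Submodule.sum_mem _ fun l hl => C_mul_mem_degLT _ ?_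
      rw [Finset.mem_Icc] at hl
      -- Either `q_{n-l}` is too short to be affected, or its change loses `l - 1 ≥ 1` degrees
      -- compared with that of `q_{n-1}`.
      by_cases h : k + 1 + N + 1 - l ≤ k
      · rw [qPoly_succ_sub_eq_zero f h]; exact zero_mem _
      · have := qPoly_succ_sub_mem hfh hk (N + 1 - l)
        rw [show k + 1 + (N + 1 - l) = k + 1 + N + 1 - l by omega] at this
        exact degLT_mono (by omega) this
    have h3 : s = (S.r - C (cf p (k + 1 + N + 1) 0) * x * headChange f (k + 1) (k + 1 + N))
        - C (cf p (k + 1 + N + 1) 0) * x * (qPoly f (k + 1) (k + 1 + N)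
          - qPoly f k (k + 1 + N) - headChange f (k + 1) (k + 1 + N))
        - ∑ l ∈ Finset.Icc 2 k, C (S.γ (k + 1 + N + 1 - l))
          * (qPoly f (k + 1) (k + 1 + N + 1 - l) - qPoly f k (k + 1 + N + 1 - l)) := by
      rw [hs, hS.residual, e1]
      simp only [hold, mul_sub, Finset.sum_sub_distrib]
      ring
    rw [h3]
    exact sub_mem (sub_mem hmain h1) h2
  have hprod : ∏ i ∈ Finset.Icc 1 (N + 1), ξ i ≠ 0 := by
    refine Finset.prod_ne_zero_iff.mpr fun i hi => hp.nonzero _ (hξ.isRoot ?_)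
    rw [Finset.mem_Icc] at hi ⊢
    omega
  refine ⟨hα, hβ, ?_, ?_, ?_⟩
  · rw [hr', Finset.sum_Icc_succ_top (by omega), hγ', Function.update_self, ← sub_sub, hs]
    refine congrArg (fun a => _ - a - C c * _) (Finset.sum_congr rfl fun l hl => ?_)
    rw [Finset.mem_Icc] at hl
    rw [Function.update_of_ne (by omega)]
  · rw [hr', e2]
    exact sub_mem hsmem (C_mul_mem_degLT _ (qPoly_mem hfh (by omega) _))
  · rw [hr', cf_sub, cf_C_mul, cf_qPoly hα hβ (by omega), hc, e2]
    have h1 : ((-1 : ℂ) ^ (N + 1)) * (-1) ^ (N + 1) = 1 := by rw [← mul_pow]; simp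
    field_simp
    linear_combination (-cf s 0 (N + 1)) * h1

/-- The alternative `m = 0` covers `n = 1`, where no step is performed. -/
lemma loopInvariant_loop {m : ℕ} (hm : m + 1 < n ∨ m = 0) :
    LoopInvariant n p ξ (m + 1) (loop n p ξ m) := by
  induction m with
  | zero => exact loopInvariant_initState hn hp hξ
  | succ m ih => exact loopInvariant_step hn hp hξ (by omega) (by omega) (ih (by omega))

/-- The algorithm produces a determinantal representation. -/
theorem isDetRep_algorithm : IsDetRep p (algorithm n p ξ) := by
  obtain ⟨N, rfl⟩ : ∃ N, n = N + 1 := ⟨n - 1, by omega⟩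
  have hI := loopInvariant_loop (m := N + 1 - 2) hn hp hξ (by omega)
  set S := loop (N + 1) p ξ (N + 1 - 2) with hS
  set k := N + 1 - 2 + 1 with hk
  set f := lin (N + 1) S.α S.β with hf
  -- For `n ≥ 2` the residual has degree at most `1` and no term in `y`. For `n = 1` it is a
  -- constant whose vanishing is the invariant.
  have hr : S.r = C (cf S.r 0 0) + C (cf S.r 1 0) * x := by
    refine ext_cf fun i j => ?_
    have hx : cf (C (cf S.r 0 0) + C (cf S.r 1 0) * x) i j
        = (if 0 = i ∧ 0 = j then cf S.r 0 0 else 0)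
          + if 1 = i ∧ 0 = j then cf S.r 1 0 else 0 := by
      rw [← cf_C_mul_x_pow_mul_y_pow, ← cf_C_mul_x_pow_mul_y_pow, ← cf_add]
      simp
    rw [hx]
    by_cases h0 : i = 0 ∧ j = 0
    · obtain ⟨rfl, rfl⟩ := h0; simp
    by_cases h1 : i = 1 ∧ j = 0
    · obtain ⟨rfl, rfl⟩ := h1; simp
    rw [if_neg (by omega), if_neg (by omega), add_zero]
    by_cases h2 : i = 0 ∧ j = N + 1 - k
    · rw [h2.1, h2.2]; exact hI.vanish
    · exact hI.degree i j (by omega)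
  -- The rows use all `f_{iℓ}` with `ℓ ≤ i ≤ N`, so the truncation of `q` at `ℓ ≤ k` is void; for `N
  -- = 0` there are no such rows.
  have hlast : N = 0 ∨ k = N := by omega
  have hrow : ∀ i j : Fin (N + 1), i ≠ 0 →
      ((algorithm (N + 1) p ξ).A.map C + x • (algorithm (N + 1) p ξ).B.map C
        + y • (algorithm (N + 1) p ξ).C.map C : Matrix (Fin (N + 1)) (Fin (N + 1)) Poly) i j
      = if (j : ℕ) = i then 1 else if (j : ℕ) < i then -f i (i - j) else 0 := by
    intro i j hi
    have h0 : (i : ℕ) ≠ 0 := fun h => hi (Fin.ext h)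
    simp only [algorithm, ← hS, Matrix.add_apply, Matrix.smul_apply, Matrix.map_apply,
      Matrix.of_apply, if_neg h0, smul_eq_mul, hf, lin, Fin.ext_iff, Fin.lt_def,
      eq_comm (a := (i : ℕ)) (b := (j : ℕ))]
    rcases lt_trichotomy (j : ℕ) i with h | h | h
    · simp only [if_neg h.ne, if_pos h, map_neg, map_zero]
      ring
    · simp [h]
    · simp [h.ne', not_lt.mpr h.le]
  have hrow0 : ∀ j : Fin (N + 1),
      ((algorithm (N + 1) p ξ).A.map C + x • (algorithm (N + 1) p ξ).B.map C
        + y • (algorithm (N + 1) p ξ).C.map C : Matrix (Fin (N + 1)) (Fin (N + 1)) Poly) 0 j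
      = (if (j : ℕ) = 0 then S.r else 0)
        + (if (j : ℕ) ∈ Finset.Icc 1 (N - 1) then C (S.γ j) else 0)
        + (if (j : ℕ) = N then C (cf p (N + 1) 0) * x else 0) := by
    intro j
    rw [hr]
    simp only [algorithm, ← hS, Matrix.add_apply, Matrix.smul_apply, Matrix.map_apply,
      Matrix.of_apply, smul_eq_mul, Fin.val_zero, if_true, Nat.add_sub_cancel, Finset.mem_Icc,
      Fin.not_lt_zero, if_false, map_zero, mul_zero, add_zero]
    by_cases h0 : (j : ℕ) = 0
    · rw [if_pos h0, if_pos h0, if_pos h0,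
        if_neg (by omega : ¬ (1 ≤ (j : ℕ) ∧ (j : ℕ) ≤ N - 1))]
      split_ifs <;> simp only [map_add, map_zero] <;> ring
    · rw [if_neg h0, if_neg h0, if_neg h0]
      by_cases h1 : (j : ℕ) < N
      · rw [if_pos h1, if_neg (by omega : ¬ (j : ℕ) = N), if_neg (by omega : ¬ (j : ℕ) = N),
          if_pos (by omega : 1 ≤ (j : ℕ) ∧ (j : ℕ) ≤ N - 1)]
        simp
      · rw [if_neg h1, if_pos (by omega : (j : ℕ) = N), if_pos (by omega : (j : ℕ) = N),
          if_neg (by omega : ¬ (1 ≤ (j : ℕ) ∧ (j : ℕ) ≤ N - 1))]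
        simp [mul_comm]
  rw [IsDetRep, det_eq_of_hessenberg _ (fun j => qPoly f k j) (by simp [qPoly_zero])]
  · simp only [hrow0]
    rw [Fin.sum_univ_eq_sum_range (fun j => ((if j = 0 then S.r else 0)
        + (if j ∈ Finset.Icc 1 (N - 1) then C (S.γ j) else 0)
        + (if j = N then C (cf p (N + 1) 0) * x else 0)) * qPoly f k j)]
    simp only [add_mul, Finset.sum_add_distrib, ite_mul, zero_mul, Finset.sum_ite_eq']
    rw [if_pos (by simp), if_pos (by simp), ← Finset.sum_filter, qPoly_zero, mul_one]
    have hsum : ∑ j ∈ Finset.range (N + 1) with j ∈ Finset.Icc 1 (N - 1), C (S.γ j) * qPoly f k j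
        = ∑ l ∈ Finset.Icc 2 k, C (S.γ (N + 1 - l)) * qPoly f k (N + 1 - l) := by
      refine Finset.sum_nbij' (fun j => N + 1 - j) (fun l => N + 1 - l) ?_ ?_ ?_ ?_ ?_
      all_goals simp only [Finset.mem_filter, Finset.mem_range, Finset.mem_Icc]
      · intro j hj; omega
      · intro l hl; omega
      · intro j hj; omega
      · intro l hl; omega
      · intro j hj
        rw [show N + 1 - (N + 1 - j) = j by omega]
    rw [hsum, hI.residual, Nat.add_sub_cancel]
    ring
  · intro i hi
    rw [hrow i i hi, if_pos rfl]
  · intro i j hi hij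
    rw [hrow i j hi, if_neg (by omega), if_neg (by omega)]
  · intro i hi
    have h0 : (i : ℕ) ≠ 0 := fun h => hi (Fin.ext h)
    obtain ⟨m, hm⟩ : ∃ m, (i : ℕ) = m + 1 := ⟨i - 1, by omega⟩
    have := i.2
    simp only [hrow i _ hi]
    rw [Fin.sum_univ_eq_sum_range (fun j => (if j = (i : ℕ) then 1 else
      if j < (i : ℕ) then -f i (i - j) else 0) * qPoly f k j), hm,
      ← Finset.sum_subset (Finset.range_subset_range.mpr (by omega : m + 2 ≤ N + 1)),
      Finset.sum_range_succ, if_pos rfl, one_mul, qPoly_succ, min_eq_left (by omega),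
      ← Finset.sum_range_reflect, ← Finset.sum_add_distrib]
    · refine Finset.sum_eq_zero fun j hj => ?_
      rw [Finset.mem_range] at hj
      rw [if_neg (by omega), if_pos (by omega), show m + 1 - 1 - j = m - j by omega,
        show m + 1 - (m - j) = j + 1 by omega]
      ring
    · intro j _ hj
      rw [Finset.mem_range] at hj
      rw [if_neg (by omega), if_neg (by omega), zero_mul]

end

/-! ### Linear substitutions -/

lemma linSubst_isHomogeneous {n : ℕ} (T : Matrix (Fin 3) (Fin 3) ℂ) {F : MvPolynomial (Fin 3) ℂ}
    (hF : F.IsHomogeneous n) : (linSubst T F).IsHomogeneous n := by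
  have := hF.aeval (fun i => ∑ j, C (T i j) * X j : Fin 3 → MvPolynomial (Fin 3) ℂ) (n := 1)
    fun i => IsHomogeneous.sum _ _ _ fun j _ => isHomogeneous_C_mul_X _ _
  rwa [one_mul] at this

lemma aeval_linSubst {R : Type*} [CommRing R] [Algebra ℂ R] (u : Fin 3 → R)
    (T : Matrix (Fin 3) (Fin 3) ℂ) (F : MvPolynomial (Fin 3) ℂ) :
    aeval u (linSubst T F) = aeval (fun i => ∑ j, algebraMap ℂ R (T i j) * u j) F := by
  rw [linSubst, ← AlgHom.comp_apply, comp_aeval]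
  simp

lemma linSubst_linSubst (S T : Matrix (Fin 3) (Fin 3) ℂ) (F : MvPolynomial (Fin 3) ℂ) :
    linSubst S (linSubst T F) = linSubst (T * S) F := by
  rw [linSubst, aeval_linSubst, linSubst]
  refine congrArg (fun u => aeval u F) (_root_.funext fun i => ?_)
  simp only [Matrix.mul_apply, map_sum, map_mul, algebraMap_eq, Finset.mul_sum, Finset.sum_mul]
  rw [Finset.sum_comm]
  simp only [mul_assoc]

lemma linSubst_one (F : MvPolynomial (Fin 3) ℂ) : linSubst 1 F = F := by
  have : (fun i => ∑ j, C ((1 : Matrix (Fin 3) (Fin 3) ℂ) i j) * X j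
      : Fin 3 → MvPolynomial (Fin 3) ℂ) = X := by
    ext1 i
    simp [Matrix.one_apply, apply_ite C, ite_mul]
  rw [linSubst, this, aeval_X_left_apply]

lemma homogenize_transform (n : ℕ) (T : Matrix (Fin 3) (Fin 3) ℂ) (p : Poly) :
    homogenize n (transform n T p) = linSubst T (homogenize n p) :=
  homogenize_dehomogenize (linSubst_isHomogeneous T (homogenize_isHomogeneous n p))

lemma transform_transform (n : ℕ) (S T : Matrix (Fin 3) (Fin 3) ℂ) (p : Poly) :
    transform n S (transform n T p) = transform n (T * S) p := by
  rw [transform, homogenize_transform, linSubst_linSubst, transform]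

lemma totalDegree_transform_le (n : ℕ) (T : Matrix (Fin 3) (Fin 3) ℂ) (p : Poly) :
    (transform n T p).totalDegree ≤ n :=
  totalDegree_dehomogenize_le (linSubst_isHomogeneous T (homogenize_isHomogeneous n p))

lemma topPoly_transform (n : ℕ) (T : Matrix (Fin 3) (Fin 3) ℂ) (p : Poly) :
    topPoly n (transform n T p) =
      aeval (fun i => Polynomial.C (T i 0) * Polynomial.X + Polynomial.C (T i 1))
        (homogenize n p) := by
  rw [topPoly_eq_aeval_homogenize, homogenize_transform, aeval_linSubst]
  simp [Fin.sum_univ_three, Polynomial.algebraMap_eq]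

/-- Along the line `v + X u` a form of degree `n` grows like its value at the direction `u`. So
`p_{n0}` after a substitution is `p_h` at the first column of `T`. -/
lemma coeff_aeval_linear {n : ℕ} {F : MvPolynomial (Fin 3) ℂ} (hF : F.IsHomogeneous n)
    (u v : Fin 3 → ℂ) :
    (aeval (fun i => Polynomial.C (u i) * Polynomial.X + Polynomial.C (v i)) F).coeff n
      = eval u F := by
  refine homogeneous_induction (P := fun F => (aeval (fun i => Polynomial.C (u i) * Polynomial.X
    + Polynomial.C (v i)) F).coeff n = eval u F) (by simp) ?_ ?_ hF
  · intro a b ha hb; rw [map_add, Polynomial.coeff_add, ha, hb, map_add]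
  · intro e c he
    have he' : n = e 0 * 1 + e 1 * 1 + e 2 * 1 := by
      rw [← he, Finsupp.degree_eq_sum, Fin.sum_univ_three]; ring
    have hd : ∀ i, (Polynomial.C (u i) * Polynomial.X + Polynomial.C (v i)).natDegree ≤ 1 :=
      fun i => Polynomial.natDegree_linear_le
    have hp : ∀ i, ((Polynomial.C (u i) * Polynomial.X + Polynomial.C (v i)) ^ e i).natDegree
        ≤ e i * 1 := fun i => Polynomial.natDegree_pow_le_of_le _ (hd i)
    rw [aeval_monomial, eval_monomial, Finsupp.prod_fintype _ _ (by simp),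
      Finsupp.prod_fintype _ _ (by simp), Fin.prod_univ_three, Fin.prod_univ_three,
      Polynomial.algebraMap_eq, Polynomial.coeff_C_mul, he',
      Polynomial.coeff_mul_add_eq_of_natDegree_le
        (Polynomial.natDegree_mul_le_of_le (hp 0) (hp 1)) (hp 2),
      Polynomial.coeff_mul_add_eq_of_natDegree_le (hp 0) (hp 1),
      Polynomial.coeff_pow_of_natDegree_le (hd 0), Polynomial.coeff_pow_of_natDegree_le (hd 1),
      Polynomial.coeff_pow_of_natDegree_le (hd 2)]
    simp

lemma cf_eq_coeff_topPoly (n : ℕ) (p : Poly) : cf p n 0 = (topPoly n p).coeff n := by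
  rw [topPoly_coeff, if_pos le_rfl, Nat.sub_self]

lemma cf_transform_lead (n : ℕ) (T : Matrix (Fin 3) (Fin 3) ℂ) (p : Poly) :
    cf (transform n T p) n 0 = eval (fun i => T i 0) (homogenize n p) := by
  rw [cf_eq_coeff_topPoly, topPoly_transform, coeff_aeval_linear (homogenize_isHomogeneous n p)]

lemma totalDegree_eq_of_lead {n : ℕ} {p : Poly} (h : p.totalDegree ≤ n) (hl : cf p n 0 ≠ 0) :
    p.totalDegree = n := by
  refine h.antisymm (not_lt.mp fun hlt => hl ?_)
  obtain ⟨m, rfl⟩ : ∃ m, n = m + 1 := ⟨n - 1, by omega⟩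
  exact mem_degLT_succ.mpr (Nat.le_of_lt_succ hlt) _ _ (by omega)

/-! ### Pencils -/

/-- The determinant of the homogeneous pencil `z A + x B + y C`. -/
def homDet {m : ℕ} (M : Pencil m) : MvPolynomial (Fin 3) ℂ :=
  ((X 2 : MvPolynomial (Fin 3) ℂ) • M.A.map C + (X 0 : MvPolynomial (Fin 3) ℂ) • M.B.map C
    + (X 1 : MvPolynomial (Fin 3) ℂ) • M.C.map C :
      Matrix (Fin m) (Fin m) (MvPolynomial (Fin 3) ℂ)).det

lemma homDet_isHomogeneous {m : ℕ} (M : Pencil m) : (homDet M).IsHomogeneous m := by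
  rw [homDet, Matrix.det_apply']
  refine IsHomogeneous.sum _ _ _ fun σ _ => ?_
  have h1 := IsHomogeneous.prod Finset.univ (fun i => ((X 2 : MvPolynomial (Fin 3) ℂ) • M.A.map C
    + (X 0 : MvPolynomial (Fin 3) ℂ) • M.B.map C + (X 1 : MvPolynomial (Fin 3) ℂ) • M.C.map C :
      Matrix (Fin m) (Fin m) (MvPolynomial (Fin 3) ℂ)) (σ i) i) (fun _ => 1) fun i _ => by
    simp only [Matrix.add_apply, Matrix.smul_apply, Matrix.map_apply, smul_eq_mul, mul_comm (X _)]
    exact ((isHomogeneous_C_mul_X _ _).add (isHomogeneous_C_mul_X _ _)).add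
      (isHomogeneous_C_mul_X _ _)
  simp only [Finset.sum_const, Finset.card_univ, Fintype.card_fin, smul_eq_mul, mul_one] at h1
  have h2 := h1.C_mul ((Equiv.Perm.sign σ : ℤ) : ℂ)
  rwa [map_intCast] at h2

lemma isDetRep_iff {m : ℕ} (p : Poly) (M : Pencil m) :
    IsDetRep p M ↔ dehomogenize (homDet M) = p := by
  have : dehomogenize (homDet M) = (M.A.map C + x • M.B.map C + y • M.C.map C :
      Matrix (Fin m) (Fin m) Poly).det := by
    rw [dehomogenize_eq, homDet, AlgHom.map_det]
    congr 1
    ext1 i j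
    simp [dehomogenizeHom, algebraMap_eq]
  rw [this, IsDetRep]

lemma homDet_pullback {n : ℕ} (T : Matrix (Fin 3) (Fin 3) ℂ) (M : Pencil n) :
    homDet (pullback T M) = linSubst T⁻¹ (homDet M) := by
  rw [linSubst, homDet, homDet, AlgHom.map_det]
  congr 1
  ext1 i j
  simp [pullback, algebraMap_eq, Fin.sum_univ_three]
  ring

/-- The determinant of the homogeneous pencil and `p_h ∘ T` are forms of degree `n` that agree at `z
= 1`, hence everywhere. Now `T⁻¹` may be substituted. -/
lemma isDetRep_pullback {n : ℕ} {T : Matrix (Fin 3) (Fin 3) ℂ} (hT : T.det ≠ 0) {p : Poly}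
    (hp : p.totalDegree ≤ n) {M : Pencil n} (hM : IsDetRep (transform n T p) M) :
    IsDetRep p (pullback T M) := by
  rw [isDetRep_iff] at hM ⊢
  have h := congrArg (homogenize n) hM
  rw [homogenize_dehomogenize (homDet_isHomogeneous M), homogenize_transform] at h
  rw [homDet_pullback, h, linSubst_linSubst, Matrix.mul_nonsing_inv _ (isUnit_iff_ne_zero.mpr hT),
    linSubst_one, dehomogenize_homogenize hp]

lemma totalDegree_le_of_isDetRep {m : ℕ} {p : Poly} {M : Pencil m} (hM : IsDetRep p M) :
    p.totalDegree ≤ m := by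
  rw [← (isDetRep_iff p M).mp hM]
  exact totalDegree_dehomogenize_le (homDet_isHomogeneous M)

/-! ### The shift -/

lemma simpleRoots_iff {f : Polynomial ℂ} (hf : f ≠ 0) :
    SimpleRoots f ↔ ∀ ζ, f.IsRoot ζ → f.derivative.eval ζ ≠ 0 := by
  refine forall₂_congr fun ζ hζ => ?_
  have h1 := (Polynomial.rootMultiplicity_pos hf).mpr hζ
  have h2 := Polynomial.one_lt_rootMultiplicity_iff_isRoot (t := ζ) hf
  rw [and_iff_right hζ, Polynomial.IsRoot] at h2
  rw [Ne, ← h2]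
  omega

section

variable {n : ℕ} {p : Poly} {s : ℂ}

lemma topPoly_ne_zero (h : cf p n 0 ≠ 0) : topPoly n p ≠ 0 := fun h0 => h <| by
  rw [cf_eq_coeff_topPoly, h0, Polynomial.coeff_zero]

lemma topPoly_natDegree (h : cf p n 0 ≠ 0) : (topPoly n p).natDegree = n :=
  (topPoly_natDegree_le n p).antisymm
    (Polynomial.le_natDegree_of_ne_zero (by rwa [← cf_eq_coeff_topPoly]))

lemma exists_isRoot_topPoly (hn : 1 ≤ n) (h : cf p n 0 ≠ 0) : ∃ s, (topPoly n p).IsRoot s := by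
  refine IsAlgClosed.exists_root _ fun hd => ?_
  have : (topPoly n p).natDegree = 0 := by rw [Polynomial.natDegree, hd]; rfl
  rw [topPoly_natDegree h] at this
  omega

/-- At infinity, where `z = 0`, the shift is the translation by `s`; `t` plays no role. -/
lemma topPoly_transform_shiftMatrix (q : Poly) (n : ℕ) (s : ℂ) :
    topPoly n (transform n (shiftMatrix n p s) q)
      = (topPoly n q).comp (Polynomial.X + Polynomial.C s) := by
  rw [topPoly_transform, topPoly_eq_aeval_homogenize, ← Polynomial.coe_compRingHom_apply]
  have : Polynomial.compRingHom (Polynomial.X + Polynomial.C s)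
      (aeval ![Polynomial.X, 1, 0] (homogenize n q))
      = (Polynomial.aeval (Polynomial.X + Polynomial.C s) : Polynomial ℂ →ₐ[ℂ] Polynomial ℂ)
        (aeval ![Polynomial.X, 1, 0] (homogenize n q)) := rfl
  rw [this, ← AlgHom.comp_apply, comp_aeval]
  refine congrArg (fun u => aeval u (homogenize n q)) (funext fun i => ?_)
  fin_cases i <;> simp [shiftMatrix]

lemma cf_transform_lead_of_col {T : Matrix (Fin 3) (Fin 3) ℂ}
    (hT : (fun i => T i 0) = ![1, 0, 0]) (q : Poly) (n : ℕ) :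
    cf (transform n T q) n 0 = cf q n 0 := by
  rw [cf_transform_lead, hT, cf_eq_coeff_topPoly, topPoly_eq_aeval_homogenize,
    ← coeff_aeval_linear (homogenize_isHomogeneous n q) _ ![0, 1, 0]]
  refine congrArg (fun u => (aeval u (homogenize n q) : Polynomial ℂ).coeff n)
    (_root_.funext fun i => ?_)
  fin_cases i <;> simp

lemma cf_transform_shiftMatrix_lead (q : Poly) (n : ℕ) (s : ℂ) :
    cf (transform n (shiftMatrix n p s) q) n 0 = cf q n 0 :=
  cf_transform_lead_of_col (by ext i; fin_cases i <;> simp [shiftMatrix]) q n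

/-- With `X` in the role of `z`, the terms free of `z` contribute the derivative of `h (s + t X)` at
`0`, and the terms with one factor `z` contribute their value at `X = 0`. -/
lemma aeval_homogenize_coeff_one (q : Poly) (s t : ℂ) :
    (aeval ![Polynomial.C s + Polynomial.C t * Polynomial.X, 1, Polynomial.X]
      (homogenize n q)).coeff 1
      = t * (topPoly n q).derivative.eval s + ∑ i ∈ Finset.range n, cf q i (n - 1 - i) * s ^ i := by
  have h0 : ∀ i, ((Polynomial.C s + Polynomial.C t * Polynomial.X) ^ i).coeff 0 = s ^ i := fun i => by
    rw [Polynomial.coeff_zero_eq_eval_zero]; simp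
  have h1 : ∀ i : ℕ, ((Polynomial.C s + Polynomial.C t * Polynomial.X) ^ i).coeff 1
      = i * (s ^ (i - 1) * t) := fun i => by
    have := Polynomial.coeff_derivative ((Polynomial.C s + Polynomial.C t * Polynomial.X) ^ i) 0
    simp only [zero_add, Nat.cast_zero, mul_one] at this
    rw [← this, Polynomial.coeff_zero_eq_eval_zero, Polynomial.derivative_pow]
    simp [mul_assoc]
  have hterm : ∀ i m : ℕ, ((Polynomial.C s + Polynomial.C t * Polynomial.X) ^ i
      * Polynomial.X ^ m).coeff 1 = if m = 0 then i * (s ^ (i - 1) * t) else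
        if m = 1 then s ^ i else 0 := fun i m => by
    rw [Polynomial.coeff_mul_X_pow']
    rcases m with _ | _ | m
    · simp [h1]
    · simp [h0]
    · simp
  have hin : ∀ i ∈ Finset.range (n + 1), ∑ j ∈ Finset.range (n + 1 - i),
      cf q i j * (if n - i - j = 0 then i * (s ^ (i - 1) * t) else
        if n - i - j = 1 then s ^ i else 0)
      = t * (cf q i (n - i) * i * s ^ (i - 1)) + if i < n then cf q i (n - 1 - i) * s ^ i else 0 := by
    intro i hi
    rw [Finset.mem_range] at hi
    rw [show n + 1 - i = n - i + 1 by omega, Finset.sum_range_succ, if_pos (by omega), add_comm]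
    congr 1
    · ring
    · by_cases h : i < n
      · rw [if_pos h, show n - i = n - 1 - i + 1 by omega, Finset.sum_range_succ,
          if_neg (by omega), if_pos (by omega), Finset.sum_eq_zero, zero_add]
        intro j hj
        rw [Finset.mem_range] at hj
        rw [if_neg (by omega), if_neg (by omega), mul_zero]
      · rw [if_neg h, show n - i = 0 by omega, Finset.sum_range_zero]
  have hd : (topPoly n q).derivative.eval s
      = ∑ i ∈ Finset.range (n + 1), cf q i (n - i) * i * s ^ (i - 1) := by
    simp [topPoly, Polynomial.eval_finsetSum, mul_assoc, Polynomial.derivative_X_pow]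
  simp only [homogenize, map_sum, map_mul, map_pow, aeval_X, aeval_C, Polynomial.finsetSum_coeff]
  simp only [Polynomial.algebraMap_eq, Matrix.cons_val_zero, Matrix.cons_val_one, Matrix.cons_val,
    one_pow, mul_one, mul_assoc, Polynomial.coeff_C_mul, hterm]
  rw [Finset.sum_congr rfl hin, Finset.sum_add_distrib, hd, Finset.mul_sum,
    Finset.sum_range_succ (fun i => if i < n then _ else _), if_neg (lt_irrefl n), add_zero]
  exact congrArg _ (Finset.sum_congr rfl fun i hi => if_pos (Finset.mem_range.mp hi))

lemma cf_eq_aeval_coeff_one (hn : 1 ≤ n) (q : Poly) :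
    cf q 0 (n - 1) = (aeval ![0, 1, Polynomial.X] (homogenize n q) : Polynomial ℂ).coeff 1 := by
  have := aeval_homogenize_coeff_one (n := n) q 0 0
  rw [zero_mul, zero_add, Finset.sum_eq_single 0] at this
  · simpa using this.symm
  · intro i _ hi; rw [zero_pow hi, mul_zero]
  · intro h; simp at h; omega

/-- The coefficient is an affine function of `t` with slope `h'(s)`, and `shiftT` is its zero. -/
lemma cf_transform_shiftMatrix (hn : 1 ≤ n) (h : (topPoly n p).derivative.eval s ≠ 0) :
    cf (transform n (shiftMatrix n p s) p) 0 (n - 1) = 0 := by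
  have h1 := aeval_homogenize_coeff_one (n := n) p s (shiftT n p s)
  rw [shiftT, div_mul_cancel₀ _ h, neg_add_cancel] at h1
  rw [cf_eq_aeval_coeff_one hn, homogenize_transform, aeval_linSubst, ← h1]
  refine congrArg (fun u => (aeval u (homogenize n p) : Polynomial ℂ).coeff 1) (_root_.funext fun i => ?_)
  fin_cases i <;> simp [shiftMatrix, shiftT, Fin.sum_univ_three, Polynomial.algebraMap_eq]

variable (hn : 1 ≤ n) (hp : IsGood n p) (hs : (topPoly n p).IsRoot s)
include hp

lemma isGood_transform_shiftMatrix : IsGood n (transform n (shiftMatrix n p s) p) := by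
  have hl : cf (transform n (shiftMatrix n p s) p) n 0 ≠ 0 := by
    rw [cf_transform_shiftMatrix_lead]; exact hp.lead
  refine ⟨totalDegree_eq_of_lead (totalDegree_transform_le _ _ _) hl, hl, ?_⟩
  rw [simpleRoots_iff (topPoly_ne_zero hl)]
  intro ζ hζ
  rw [topPoly_transform_shiftMatrix, Polynomial.IsRoot, Polynomial.eval_comp] at hζ
  rw [topPoly_transform_shiftMatrix, Polynomial.derivative_comp]
  simpa using (simpleRoots_iff (topPoly_ne_zero hp.lead)).mp hp.simple _ hζ

include hn hs

lemma isAlgInput_transform_shiftMatrix : IsAlgInput n (transform n (shiftMatrix n p s) p) := by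
  have hg := isGood_transform_shiftMatrix hp (s := s)
  have hvan : cf (transform n (shiftMatrix n p s) p) 0 n = 0 := by
    have h := topPoly_coeff n (transform n (shiftMatrix n p s) p) 0
    rw [if_pos (Nat.zero_le _), Nat.sub_zero] at h
    rw [← h, topPoly_transform_shiftMatrix, Polynomial.coeff_zero_eq_eval_zero,
      Polynomial.eval_comp]
    simpa using hs
  have hv0 : vPoly n (transform n (shiftMatrix n p s) p) ≠ 0 := fun h0 =>
    topPoly_ne_zero hg.lead (by rw [topPoly_eq_X_mul_vPoly hvan, h0, mul_zero])
  -- The derivative of `X * v` at a zero `ζ` of `v` is `ζ v'(ζ)`. That it is nonzero shows at once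
  -- that `ζ` is nonzero and simple.
  have key : ∀ ζ, (vPoly n (transform n (shiftMatrix n p s) p)).IsRoot ζ →
      ζ * (vPoly n (transform n (shiftMatrix n p s) p)).derivative.eval ζ ≠ 0 := by
    intro ζ hζ
    have := (simpleRoots_iff (topPoly_ne_zero hg.lead)).mp hg.simple ζ
      (by rw [topPoly_eq_X_mul_vPoly hvan, Polynomial.IsRoot, Polynomial.eval_mul, hζ.eq_zero,
        mul_zero])
    rw [topPoly_eq_X_mul_vPoly hvan, Polynomial.derivative_mul] at this
    simpa [hζ.eq_zero] using this
  exact ⟨hg.degree, hg.lead, (simpleRoots_iff hv0).mpr fun ζ hζ => right_ne_zero_of_mul (key ζ hζ),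
    fun ζ hζ => left_ne_zero_of_mul (key ζ hζ), hvan, cf_transform_shiftMatrix hn
      ((simpleRoots_iff (topPoly_ne_zero hp.lead)).mp hp.simple s hs)⟩

end

lemma exists_enumerates {n : ℕ} (hn : 1 ≤ n) {p : Poly} (h : cf p n 0 ≠ 0) :
    ∃ ξ, Enumerates n p ξ := by
  have hcard : (vPoly n p).roots.toList.length = n - 1 := by
    rw [Multiset.length_toList, IsAlgClosed.card_roots_eq_natDegree, (vPoly_leadingCoeff hn h).1]
  refine ⟨fun i => (vPoly n p).roots.toList.getD (i - 1) 0, ?_⟩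
  rw [Enumerates, Nat.Icc_eq_range']
  conv_rhs => rw [← Multiset.coe_toList (vPoly n p).roots]
  rw [Multiset.map_coe]
  congr 1
  refine List.ext_getElem (by simp [hcard]) fun i h1 h2 => ?_
  simp [List.getElem?_eq_getElem h2]

lemma shiftMatrix_det (n : ℕ) (p : Poly) (s : ℂ) : (shiftMatrix n p s).det = 1 := by
  simp [shiftMatrix, Matrix.det_fin_three]

lemma isDetRep_construction {n : ℕ} (hn : 1 ≤ n) {p : Poly} (hp : p.totalDegree ≤ n)
    {T : Matrix (Fin 3) (Fin 3) ℂ} (hT : T.det ≠ 0) (hg : IsGood n (transform n T p)) {s : ℂ}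
    (hs : (topPoly n (transform n T p)).IsRoot s) {ξ : ℕ → ℂ}
    (hξ : Enumerates n (normalForm n p T s) ξ) : IsDetRep p (construction n p T s ξ) := by
  refine isDetRep_pullback hT hp (isDetRep_pullback ?_ (totalDegree_transform_le _ _ _) ?_)
  · rw [shiftMatrix_det]; exact one_ne_zero
  · exact isDetRep_algorithm hn (isAlgInput_transform_shiftMatrix hn hg hs) hξ

/-! ### Generic changes of variables -/

/-- Gauss's lemma: a factor of a monic polynomial over the fraction field is a scalar multiple of a
monic polynomial over `R`, so a square factor descends to `R`. -/
lemma squarefree_map_fractionRing {R : Type*} [CommRing R] [IsDomain R] [IsIntegrallyClosed R]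
    {f : Polynomial R} (hf : f.Monic) (hs : Squarefree f) :
    Squarefree (f.map (algebraMap R (FractionRing R))) := by
  intro a ha
  have ha0 : a ≠ 0 := by
    rintro rfl
    rw [mul_zero, zero_dvd_iff] at ha
    exact (hf.map _).ne_zero ha
  obtain ⟨g, hg⟩ := IsIntegrallyClosed.eq_map_mul_C_of_dvd (FractionRing R) hf
    (dvd_of_mul_right_dvd ha)
  have hlc := Polynomial.leadingCoeff_ne_zero.mpr ha0
  have hinj := IsFractionRing.injective R (FractionRing R)
  have hgm : g.Monic := by
    have h := congrArg Polynomial.leadingCoeff hg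
    rw [Polynomial.leadingCoeff_mul, Polynomial.leadingCoeff_C,
      Polynomial.leadingCoeff_map_of_injective hinj] at h
    exact hinj (by rw [map_one]; exact mul_right_cancel₀ hlc (by rw [h, one_mul]))
  have hdvd : (g * g).map (algebraMap R (FractionRing R)) ∣ f.map (algebraMap R _) := by
    refine dvd_trans ?_ ha
    rw [Polynomial.map_mul]
    exact mul_dvd_mul (Dvd.intro _ hg) (Dvd.intro _ hg)
  have hu := hs g (hf.dvd_of_fraction_map_dvd_fraction_map (hgm.mul hgm) hdvd)
  rw [← hg]
  exact (hu.map (Polynomial.mapRingHom (algebraMap R (FractionRing R)))).mul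
    (Polynomial.isUnit_C.mpr (isUnit_iff_ne_zero.mpr hlc))

lemma resultant_derivative_ne_zero_iff {K : Type*} [Field K] [CharZero K] {f : Polynomial K}
    {n : ℕ} (hn : 1 ≤ n) (hf : f.natDegree = n) :
    f.resultant f.derivative n (n - 1) ≠ 0 ↔ f.Separable := by
  have h := Polynomial.resultant_eq_zero_iff (f := f) (g := f.derivative)
  rw [Polynomial.natDegree_derivative, hf] at h
  have hf0 : f ≠ 0 := by rintro rfl; simp at hf; omega
  rw [Ne, h, Polynomial.Separable]
  tauto

lemma resultant_derivative_ne_zero_of_squarefree {R : Type*} [CommRing R] [IsDomain R]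
    [IsIntegrallyClosed R] [CharZero R] {f : Polynomial R} (hf : f.Monic) (hs : Squarefree f)
    (hn : 1 ≤ f.natDegree) :
    f.resultant f.derivative f.natDegree (f.natDegree - 1) ≠ 0 := by
  have hinj := IsFractionRing.injective R (FractionRing R)
  have : CharZero (FractionRing R) := charZero_of_injective_algebraMap hinj
  have h := (resultant_derivative_ne_zero_iff hn (hf.natDegree_map (algebraMap R _))).mpr
    (PerfectField.separable_iff_squarefree.mpr (squarefree_map_fractionRing hf hs))
  rw [Polynomial.derivative_map, Polynomial.resultant_map_map] at h
  exact fun h0 => h (by rw [h0, map_zero])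

lemma simpleRoots_of_separable {f : Polynomial ℂ} (hf : f.Separable) : SimpleRoots f :=
  fun _ hζ => (Polynomial.rootMultiplicity_le_one_of_separable hf _).antisymm
    ((Polynomial.rootMultiplicity_pos hf.ne_zero).mpr hζ)

/-- The polynomial `p_h (T (ξ, 1, 0))` in `ξ` for a matrix `T` of indeterminates. -/
def genericTopPoly (n : ℕ) (p : Poly) : Polynomial (MvPolynomial (Fin 3 × Fin 3) ℂ) :=
  aeval (fun i => Polynomial.C (X (i, 0)) * Polynomial.X + Polynomial.C (X (i, 1)))
    (homogenize n p)

lemma genericTopPoly_map (n : ℕ) (p : Poly) (T : Matrix (Fin 3) (Fin 3) ℂ) :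
    (genericTopPoly n p).map (eval fun ij => T ij.1 ij.2) = topPoly n (transform n T p) := by
  have h : (genericTopPoly n p).map (eval fun ij => T ij.1 ij.2)
      = Polynomial.mapAlgHom (aeval (R := ℂ) fun ij : Fin 3 × Fin 3 => T ij.1 ij.2)
        (genericTopPoly n p) := rfl
  rw [h, genericTopPoly, ← AlgHom.comp_apply, comp_aeval, topPoly_transform]
  simp

/-- A polynomial in the entries of `T` which does not vanish exactly at the nonsingular matrices
that give a polynomial with `p_{n0} ≠ 0` and simple zeros of `h`. -/
def genericityPoly (n : ℕ) (p : Poly) : MvPolynomial (Fin 3 × Fin 3) ℂ :=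
  (Matrix.of fun i j => X (i, j) : Matrix (Fin 3) (Fin 3) (MvPolynomial (Fin 3 × Fin 3) ℂ)).det
    * (genericTopPoly n p).coeff n
    * (genericTopPoly n p).resultant (genericTopPoly n p).derivative n (n - 1)

lemma eval_genericityPoly_ne_zero_iff {n : ℕ} (hn : 1 ≤ n) (p : Poly)
    (T : Matrix (Fin 3) (Fin 3) ℂ) :
    eval (fun ij => T ij.1 ij.2) (genericityPoly n p) ≠ 0 ↔
      T.det ≠ 0 ∧ cf (transform n T p) n 0 ≠ 0 ∧ (topPoly n (transform n T p)).Separable := by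
  have hdet : eval (fun ij => T ij.1 ij.2) (Matrix.of fun i j => X (i, j) :
      Matrix (Fin 3) (Fin 3) (MvPolynomial (Fin 3 × Fin 3) ℂ)).det = T.det := by
    rw [RingHom.map_det]
    congr 1
    ext i j
    simp
  rw [genericityPoly, map_mul, map_mul, hdet, ← Polynomial.coeff_map,
    ← Polynomial.resultant_map_map, ← Polynomial.derivative_map, genericTopPoly_map,
    ← cf_eq_coeff_topPoly, mul_ne_zero_iff, mul_ne_zero_iff, and_assoc]
  -- The resultant is taken with formal degrees `n` and `n - 1`, so it commutes with evaluation at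
  -- every `T`. The factor `p_{n0}` ensures that these are the true degrees.
  refine and_congr_right fun _ => and_congr_right fun hl => ?_
  rw [resultant_derivative_ne_zero_iff hn (topPoly_natDegree hl)]

lemma isGood_of_eval_ne_zero {n : ℕ} (hn : 1 ≤ n) {p : Poly} {T : Matrix (Fin 3) (Fin 3) ℂ}
    (h : eval (fun ij => T ij.1 ij.2) (genericityPoly n p) ≠ 0) :
    T.det ≠ 0 ∧ IsGood n (transform n T p) := by
  obtain ⟨h1, h2, h3⟩ := (eval_genericityPoly_ne_zero_iff hn p T).mp h
  exact ⟨h1, totalDegree_eq_of_lead (totalDegree_transform_le _ _ _) h2, h2,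
    simpleRoots_of_separable h3⟩

/-- The automorphism `x ↦ a x + y`, `y ↦ x`. -/
def swapShear (a : ℂ) : Poly ≃ₐ[ℂ] Poly :=
  AlgEquiv.ofAlgHom (aeval ![C a * x + y, x]) (aeval ![y, x - C a * y])
    (by ext i : 1; fin_cases i <;> simp [x, y, algebraMap_eq])
    (by ext i : 1; fin_cases i <;> simp [x, y, algebraMap_eq])

lemma transform_swapShear {n : ℕ} {p : Poly} (hp : p.totalDegree ≤ n) (a : ℂ) :
    transform n !![a, 1, 0; 1, 0, 0; 0, 0, 1] p = swapShear a p := by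
  conv_rhs => rw [← dehomogenize_homogenize hp]
  rw [transform, dehomogenize_eq, dehomogenizeHom, aeval_linSubst, dehomogenize_eq,
    dehomogenizeHom]
  have : swapShear a (aeval ![x, y, 1] (homogenize n p))
      = (aeval ![C a * x + y, x] : Poly →ₐ[ℂ] Poly) (aeval ![x, y, 1] (homogenize n p)) := rfl
  rw [this, ← AlgHom.comp_apply, comp_aeval]
  refine congrArg (fun u => aeval u (homogenize n p)) (_root_.funext fun i => ?_)
  fin_cases i <;> simp [Fin.sum_univ_three, algebraMap_eq, x, y]

lemma cf_transform_swapShear (n : ℕ) (p : Poly) (a : ℂ) :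
    cf (transform n !![a, 1, 0; 1, 0, 0; 0, 0, 1] p) n 0 = (topPoly n p).eval a := by
  rw [cf_transform_lead, topPoly_eq_aeval_homogenize, ← Polynomial.coe_aeval_eq_eval,
    ← AlgHom.comp_apply, comp_aeval, ← aeval_eq_eval]
  refine congrArg (fun u => aeval u (homogenize n p)) (_root_.funext fun i => ?_)
  fin_cases i <;> simp

/-- The coefficient is `h (a)`, and `h` is not the zero polynomial because the degree of `p` is
exactly `n`. -/
lemma exists_cf_transform_swapShear_ne_zero {n : ℕ} (hn : 1 ≤ n) {p : Poly}
    (hp : p.totalDegree = n) :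
    ∃ a, cf (transform n !![a, 1, 0; 1, 0, 0; 0, 0, 1] p) n 0 ≠ 0 := by
  simp only [cf_transform_swapShear]
  by_contra! h
  have h0 : topPoly n p = 0 := Polynomial.funext fun a => by rw [h, Polynomial.eval_zero]
  have := mem_degLT_of_topPoly_eq_zero (mem_degLT_succ.mpr hp.le) h0
  obtain ⟨m, rfl⟩ : ∃ m, n = m + 1 := ⟨n - 1, by omega⟩
  have := mem_degLT_succ.mp this
  omega

/-- The matrix sends `(ξ, 1, 0)` to `(ξ, v, 1)`: it makes the affine line `y = v` the line at
infinity, so `h` becomes the restriction of `q` to that line. -/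
lemma topPoly_transform_line {n : ℕ} {q : Poly} (hq : q.totalDegree ≤ n) (v : Fin 1 → ℂ) :
    topPoly n (transform n !![1, 0, 0; 0, v 0, 1; 0, 1, 0] q)
      = (finSuccEquiv ℂ 1 q).map (eval v) := by
  have h : (finSuccEquiv ℂ 1 q).map (eval v)
      = ((Polynomial.mapAlgHom (aeval (R := ℂ) v)).comp (finSuccEquiv ℂ 1).toAlgHom) q := rfl
  have h2 : (Polynomial.mapAlgHom (aeval (R := ℂ) v)).comp (finSuccEquiv ℂ 1).toAlgHom
      = aeval ![Polynomial.X, Polynomial.C (v 0)] := by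
    ext i : 1
    fin_cases i
    · simp [finSuccEquiv_X_zero]
    · have := finSuccEquiv_X_succ (R := ℂ) (n := 1) (j := 0)
      simp only [Fin.succ_zero_eq_one] at this
      simp [this]
  rw [h, h2, topPoly_transform]
  conv_rhs => rw [← dehomogenize_homogenize hq]
  rw [dehomogenize_eq, dehomogenizeHom, ← AlgHom.comp_apply, comp_aeval]
  refine congrArg (fun u => aeval u (homogenize n q)) (_root_.funext fun i => ?_)
  fin_cases i <;> simp [x, y]

lemma finSuccEquiv_monic {n : ℕ} {q : Poly} (hq : q.totalDegree ≤ n) (hl : cf q n 0 = 1) :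
    (finSuccEquiv ℂ 1 q).natDegree = n ∧ (finSuccEquiv ℂ 1 q).Monic := by
  have hcf : ∀ i (m : Fin 1 →₀ ℕ), coeff m ((finSuccEquiv ℂ 1 q).coeff i) = cf q i (m 0) := by
    intro i m
    rw [finSuccEquiv_coeff_coeff, cf]
    congr 1
    ext j
    fin_cases j
    · simp
    · simpa using Finsupp.cons_succ (0 : Fin 1) i m
  have hdeg : (finSuccEquiv ℂ 1 q).natDegree ≤ n := by
    rw [Polynomial.natDegree_le_iff_coeff_eq_zero]
    intro i hi
    ext m
    rw [hcf, coeff_zero]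
    exact mem_degLT_succ.mpr hq _ _ (by omega)
  have hc : (finSuccEquiv ℂ 1 q).coeff n = 1 := by
    ext m
    rw [hcf, coeff_one]
    split_ifs with h
    · rw [← h]; simpa using hl
    · refine mem_degLT_succ.mpr hq _ _ ?_
      have : m 0 ≠ 0 := fun h0 => h (Finsupp.ext fun j => by rw [Subsingleton.elim j 0, h0]; rfl)
      omega
  have hd : (finSuccEquiv ℂ 1 q).natDegree = n :=
    hdeg.antisymm (Polynomial.le_natDegree_of_ne_zero (by rw [hc]; exact one_ne_zero))
  exact ⟨hd, by rw [Polynomial.Monic, Polynomial.leadingCoeff, hd, hc]⟩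

lemma squarefree_map_algEquiv {A B : Type*} [CommRing A] [CommRing B] [Algebra ℂ A] [Algebra ℂ B]
    (e : A ≃ₐ[ℂ] B) {a : A} (h : Squarefree a) : Squarefree (e a) := by
  intro b hb
  have := h (e.symm b) (by simpa using map_dvd e.symm hb)
  simpa using this.map e

/-- It suffices to exhibit one good matrix. After a shear, `p` is up to a constant monic in `x` over
`ℂ[y]`; being square-free, it has a nonzero discriminant in `ℂ[y]`. A value `v` of `y` at which this
does not vanish gives a line with `n` distinct intersection points, which is then moved to infinity.
-/
lemma genericityPoly_ne_zero {n : ℕ} (hn : 1 ≤ n) {p : Poly} (hp : p.totalDegree = n)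
    (hs : Squarefree p) : genericityPoly n p ≠ 0 := by
  obtain ⟨a, ha⟩ := exists_cf_transform_swapShear_ne_zero hn hp
  set q := transform n !![a, 1, 0; 1, 0, 0; 0, 0, 1] p with hq
  set c := cf q n 0 with hc
  have hqd : q.totalDegree ≤ n := totalDegree_transform_le _ _ _
  have hqs : Squarefree q := by
    rw [hq, transform_swapShear hp.le]
    exact squarefree_map_algEquiv _ hs
  have hu : IsUnit (C c⁻¹ : Poly) := (isUnit_iff_ne_zero.mpr (inv_ne_zero ha)).map C
  have hrd : (C c⁻¹ * q).totalDegree ≤ n :=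
    mem_degLT_succ.mp (C_mul_mem_degLT _ (mem_degLT_succ.mpr hqd))
  have hrs : Squarefree (finSuccEquiv ℂ 1 (C c⁻¹ * q)) :=
    squarefree_map_algEquiv _ fun b hb => hqs b ((hu.dvd_mul_left).mp hb)
  obtain ⟨hd, hm⟩ := finSuccEquiv_monic hrd (by rw [cf_C_mul, ← hc, inv_mul_cancel₀ ha])
  have hres := resultant_derivative_ne_zero_of_squarefree hm hrs (by omega)
  rw [hd] at hres
  obtain ⟨v, hv⟩ : ∃ v, eval v ((finSuccEquiv ℂ 1 (C c⁻¹ * q)).resultant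
      (finSuccEquiv ℂ 1 (C c⁻¹ * q)).derivative n (n - 1)) ≠ 0 := by
    by_contra! h
    exact hres (MvPolynomial.funext fun v => by rw [h, map_zero])
  rw [← Polynomial.resultant_map_map, ← Polynomial.derivative_map,
    resultant_derivative_ne_zero_iff hn (by rw [hm.natDegree_map, hd])] at hv
  have hsep : (topPoly n (transform n !![1, 0, 0; 0, v 0, 1; 0, 1, 0] q)).Separable := by
    rw [topPoly_transform_line hqd]
    refine Polynomial.Separable.of_dvd hv ?_
    rw [map_mul, Polynomial.map_mul]
    exact Dvd.intro_left _ rfl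
  rw [hq, transform_transform] at hsep
  intro h0
  refine (eval_genericityPoly_ne_zero_iff hn p (!![a, 1, 0; 1, 0, 0; 0, 0, 1]
    * !![1, 0, 0; 0, v 0, 1; 0, 1, 0])).mpr ⟨?_, ?_, hsep⟩ (by rw [h0, map_zero])
  · rw [Matrix.det_mul]
    simp [Matrix.det_fin_three]
  -- Moving the line fixes the point `(1, 0, 0)`, so the leading coefficient from the shear is kept.
  · rw [← transform_transform, ← hq, cf_transform_lead_of_col]
    · exact ha
    · ext i; fin_cases i <;> simp

lemma exists_isAdmissible {n : ℕ} (hn : 1 ≤ n) {p : Poly} (hp : p.totalDegree = n)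
    (hs : Squarefree p) : ∃ T s ξ, IsAdmissible n p T s ξ := by
  obtain ⟨v, hv⟩ : ∃ v, eval v (genericityPoly n p) ≠ 0 := by
    by_contra! h
    exact genericityPoly_ne_zero hn hp hs (MvPolynomial.funext fun v => by rw [h, map_zero])
  obtain ⟨hT, hg⟩ := isGood_of_eval_ne_zero (T := Matrix.of fun i j => v (i, j)) hn hv
  obtain ⟨s, hs⟩ := exists_isRoot_topPoly hn hg.lead
  obtain ⟨ξ, hξ⟩ := exists_enumerates hn (isAlgInput_transform_shiftMatrix hn hg hs).lead
  exact ⟨_, s, ξ, hT, hg, hs, hξ⟩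

/-! ### Factorizations -/

lemma totalDegree_prod_eq {ι : Type*} (s : Finset ι) (f : ι → Poly) (hf : ∀ i ∈ s, f i ≠ 0) :
    (∏ i ∈ s, f i).totalDegree = ∑ i ∈ s, (f i).totalDegree := by
  classical
  induction s using Finset.induction_on with
  | empty => simp
  | insert a s ha ih =>
    have hs : ∀ i ∈ s, f i ≠ 0 := fun i hi => hf i (Finset.mem_insert_of_mem hi)
    rw [Finset.prod_insert ha, Finset.sum_insert ha, totalDegree_mul_of_isDomain
      (hf a (Finset.mem_insert_self a s)) (Finset.prod_ne_zero_iff.mpr hs), ih hs]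

lemma totalDegree_ne_zero_of_irreducible {f : Poly} (hf : Irreducible f) : f.totalDegree ≠ 0 := by
  intro h
  have hC := totalDegree_eq_zero_iff_eq_C.mp h
  refine hf.not_isUnit ?_
  rw [hC]
  refine (isUnit_iff_ne_zero.mpr fun h0 => hf.ne_zero ?_).map C
  rw [hC, h0, map_zero]

/-- Irreducible factors serve. As `p` is not a unit, the constant can be absorbed in one of them,
and the product is `p` itself. -/
lemma exists_isSquarefreeFactorization {p : Poly} (hp : p.totalDegree ≠ 0) :
    ∃ (k : ℕ) (f : Fin k → Poly) (d : Fin k → ℕ), IsSquarefreeFactorization p f d := by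
  have hp0 : p ≠ 0 := by rintro rfl; exact hp totalDegree_zero
  have hu : ¬ IsUnit p := fun h => hp (isUnit_iff_totalDegree_of_isReduced.mp h).2
  obtain ⟨m, hm, hprod, -⟩ := (WfDvdMonoid.not_isUnit_iff_exists_factors_eq p hp0).mp hu
  have hirr : ∀ i, Irreducible (m.toList.get i) := fun i =>
    hm _ (Multiset.mem_toList.mp (List.get_mem _ _))
  refine ⟨m.toList.length, m.toList.get, fun i => (m.toList.get i).totalDegree,
    ?_, fun i => (hirr i).squarefree, fun _ => rfl,
    fun i => Nat.one_le_iff_ne_zero.mpr (totalDegree_ne_zero_of_irreducible (hirr i))⟩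
  rw [← List.prod_ofFn, List.ofFn_get, Multiset.prod_toList, hprod]

lemma IsSquarefreeFactorization.sum_degree {k : ℕ} {p : Poly} {f : Fin k → Poly} {d : Fin k → ℕ}
    (h : IsSquarefreeFactorization p f d) : ∑ i, d i = p.totalDegree := by
  rw [← h.prod_eq, totalDegree_prod_eq _ _ fun i _ => (h.squarefree i).ne_zero]
  exact Finset.sum_congr rfl fun i _ => (h.degree i).symm

/-! ### Block-diagonal pencils -/

lemma det_blockDiagonal' {R : Type*} [CommRing R] {k : ℕ} {d : Fin k → ℕ}
    (M : ∀ i, Matrix (Fin (d i)) (Fin (d i)) R) :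
    (Matrix.blockDiagonal' M).det = ∏ i, (M i).det := by
  rw [(Matrix.blockTriangular_blockDiagonal' M).det_fintype]
  refine Finset.prod_congr rfl fun i _ => ?_
  rw [← Matrix.det_submatrix_equiv_self (Equiv.sigmaSubtype i).symm]
  congr 1
  ext a b
  exact Matrix.blockDiagonal'_apply_eq M i a b

lemma isDetRep_blockPencil {k n : ℕ} {d : Fin k → ℕ} (hd : ∑ i, d i = n) {f : Fin k → Poly}
    {M : ∀ i, Pencil (d i)} (hM : ∀ i, IsDetRep (f i) (M i)) :
    IsDetRep (∏ i, f i) (blockPencil hd M) := by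
  have h : ((blockPencil hd M).A.map C + x • (blockPencil hd M).B.map C
      + y • (blockPencil hd M).C.map C : Matrix (Fin n) (Fin n) Poly)
      = Matrix.reindex (finSigmaFinEquiv.trans (finCongr hd)) (finSigmaFinEquiv.trans (finCongr hd))
        (Matrix.blockDiagonal' ((fun i => (M i).A.map C) + x • (fun i => (M i).B.map C)
          + y • fun i => (M i).C.map C)) := by
    rw [Matrix.blockDiagonal'_add, Matrix.blockDiagonal'_add, Matrix.blockDiagonal'_smul,
      Matrix.blockDiagonal'_smul, ← Matrix.blockDiagonal'_map _ _ C_0,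
      ← Matrix.blockDiagonal'_map _ _ C_0, ← Matrix.blockDiagonal'_map _ _ C_0]
    rfl
  rw [IsDetRep, h, Matrix.det_reindex_self, det_blockDiagonal']
  exact Finset.prod_congr rfl fun i _ => hM i

lemma IsAdmissible.isDetRep {n : ℕ} (hn : 1 ≤ n) {p : Poly} (hp : p.totalDegree = n)
    {T : Matrix (Fin 3) (Fin 3) ℂ} {s : ℂ} {ξ : ℕ → ℂ} (h : IsAdmissible n p T s ξ) :
    IsDetRep p (construction n p T s ξ) :=
  isDetRep_construction hn hp.le h.nonsingular h.good h.root h.enumerates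

end

end DetRep

theorem mainTheorem3 (n : ℕ) (hn : 1 ≤ n) (p : MvPolynomial (Fin 2) ℂ)
    (hp : p.totalDegree = n) :
    -- correctness of the algorithm
    (DetRep.IsAlgInput n p → ∀ ξ : ℕ → ℂ, DetRep.Enumerates n p ξ →
      DetRep.IsDetRep p (DetRep.algorithm n p ξ)) ∧
    -- square-free polynomials: a generic linear change of variables gives the required form
    (Squarefree p → ∃ Φ : MvPolynomial (Fin 3 × Fin 3) ℂ, Φ ≠ 0 ∧
      ∀ T : Matrix (Fin 3) (Fin 3) ℂ, MvPolynomial.eval (fun ij => T ij.1 ij.2) Φ ≠ 0 →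
        T.det ≠ 0 ∧ DetRep.IsGood n (DetRep.transform n T p)) ∧
    -- from this form, the shift and the algorithm lead to a representation of order `n`
    (∀ T : Matrix (Fin 3) (Fin 3) ℂ, T.det ≠ 0 → DetRep.IsGood n (DetRep.transform n T p) →
      (∃ s, (DetRep.topPoly n (DetRep.transform n T p)).IsRoot s) ∧
      ∀ s, (DetRep.topPoly n (DetRep.transform n T p)).IsRoot s →
        DetRep.IsGood n (DetRep.normalForm n p T s) ∧
        DetRep.IsAlgInput n (DetRep.normalForm n p T s) ∧
        (∃ ξ, DetRep.Enumerates n (DetRep.normalForm n p T s) ξ) ∧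
        ∀ ξ, DetRep.Enumerates n (DetRep.normalForm n p T s) ξ →
          DetRep.IsDetRep p (DetRep.construction n p T s ξ)) ∧
    (Squarefree p → ∃ T s ξ, DetRep.IsAdmissible n p T s ξ ∧
      DetRep.IsDetRep p (DetRep.construction n p T s ξ)) ∧
    -- all polynomials: square-free factorizations and block-diagonal matrices
    (∃ (k : ℕ) (f : Fin k → MvPolynomial (Fin 2) ℂ) (d : Fin k → ℕ),
      DetRep.IsSquarefreeFactorization p f d) ∧
    (∀ (k : ℕ) (f : Fin k → MvPolynomial (Fin 2) ℂ) (d : Fin k → ℕ),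
      DetRep.IsSquarefreeFactorization p f d →
      ∃ hd : ∑ i, d i = n,
        (∃ (T : Fin k → Matrix (Fin 3) (Fin 3) ℂ) (s : Fin k → ℂ) (ξ : Fin k → ℕ → ℂ),
          ∀ i, DetRep.IsAdmissible (d i) (f i) (T i) (s i) (ξ i)) ∧
        ∀ (T : Fin k → Matrix (Fin 3) (Fin 3) ℂ) (s : Fin k → ℂ) (ξ : Fin k → ℕ → ℂ),
          (∀ i, DetRep.IsAdmissible (d i) (f i) (T i) (s i) (ξ i)) →
          DetRep.IsDetRep p (DetRep.blockPencil hd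
            fun i => DetRep.construction (d i) (f i) (T i) (s i) (ξ i))) ∧
    -- the order `n` is attained, and no smaller order is possible
    (∃ A B C : Matrix (Fin n) (Fin n) ℂ, DetRep.IsDetRep p ⟨A, B, C⟩) ∧
    (∀ (m : ℕ) (M : DetRep.Pencil m), DetRep.IsDetRep p M → n ≤ m) := by
  -- Isolated because the existence of a representation of order `n` for arbitrary `p` is deduced
  -- from it as well.
  have hblock : ∀ (k : ℕ) (f : Fin k → MvPolynomial (Fin 2) ℂ) (d : Fin k → ℕ),
      DetRep.IsSquarefreeFactorization p f d →
      ∃ hd : ∑ i, d i = n,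
        (∃ (T : Fin k → Matrix (Fin 3) (Fin 3) ℂ) (s : Fin k → ℂ) (ξ : Fin k → ℕ → ℂ),
          ∀ i, DetRep.IsAdmissible (d i) (f i) (T i) (s i) (ξ i)) ∧
        ∀ (T : Fin k → Matrix (Fin 3) (Fin 3) ℂ) (s : Fin k → ℂ) (ξ : Fin k → ℕ → ℂ),
          (∀ i, DetRep.IsAdmissible (d i) (f i) (T i) (s i) (ξ i)) →
          DetRep.IsDetRep p (DetRep.blockPencil hd
            fun i => DetRep.construction (d i) (f i) (T i) (s i) (ξ i)) := by
    intro k f d h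
    refine ⟨h.sum_degree.trans hp, ?_, fun T s ξ hadm => ?_⟩
    · choose T s ξ hadm using fun i =>
        DetRep.exists_isAdmissible (h.pos i) (h.degree i) (h.squarefree i)
      exact ⟨T, s, ξ, hadm⟩
    · have := DetRep.isDetRep_blockPencil (h.sum_degree.trans hp)
        fun i => (hadm i).isDetRep (h.pos i) (h.degree i)
      rwa [h.prod_eq] at this
  have hfac := DetRep.exists_isSquarefreeFactorization (p := p) (by omega)
  refine ⟨fun h ξ hξ => DetRep.isDetRep_algorithm hn h hξ, fun hs => ?_, fun T hT hg => ?_,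
    fun hs => ?_, hfac, hblock, ?_, fun m M hM => hp ▸ DetRep.totalDegree_le_of_isDetRep hM⟩
  · exact ⟨DetRep.genericityPoly n p, DetRep.genericityPoly_ne_zero hn hp hs,
      fun T h => DetRep.isGood_of_eval_ne_zero hn h⟩
  · refine ⟨DetRep.exists_isRoot_topPoly hn hg.lead, fun s hs => ?_⟩
    have hin := DetRep.isAlgInput_transform_shiftMatrix hn hg hs
    exact ⟨DetRep.isGood_transform_shiftMatrix hg, hin, DetRep.exists_enumerates hn hin.lead,
      fun ξ hξ => DetRep.isDetRep_construction hn hp.le hT hg hs hξ⟩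
  · obtain ⟨T, s, ξ, h⟩ := DetRep.exists_isAdmissible hn hp hs
    exact ⟨T, s, ξ, h, h.isDetRep hn hp⟩
  · obtain ⟨k, f, d, h⟩ := hfac
    obtain ⟨hd, ⟨T, s, ξ, hadm⟩, hall⟩ := hblock k f d h
    exact ⟨_, _, _, hall T s ξ hadm⟩
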